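/- Let $k$ be a field and let $A$ and $B$ be nonzero metabelian Lie algebras over $k$ (of arbitrary dimension), where a Lie algebra is called metabelian if it satisfies the identity $[[a,b],[c,d]]=0$. Let $A\ast B$ be their metabelian product, i.e. the metabelian Lie $k$-algebra given, in the variety of all metabelian Lie $k$-algebras, by the presentation whose generators are the disjoint union of generators of $A$ and of $B$ and whose relations are the relations of $A$ together with those of $B$. For a Lie algebra $L$ over $k$ let $L^2$ be the ideal generated by all products $[a,b]$, let $\mathrm{Fit}(L)$ be the ideal generated by all elements of nilpotent ideals of $L$, and let $\langle x\rangle$ be the ideal generated by $x\in L$. A nonzero $x\in L$ is a zero divisor if there is a nonzero $y\in L$ with $[\langle x\rangle,\langle y\rangle]=0$; let $D(L)$ be the set consisting of $0$ and all zero divisors of $L$. Call $L$ a semidomain if $D(L)=\mathrm{Fit}(L)$, and a strict semidomain if $D(L)=L^2$. Then $A\ast B$ is a semidomain if and only if each of $A$ and $B$ is either abelian or a strict semidomain. -/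

import Mathlib

namespace MetabelianLie

universe u v w

/-- A Lie algebra is metabelian if it satisfies the identity `(a ∘ b) ∘ (c ∘ d) = 0`. -/
def IsMetabelian (L : Type v) [LieRing L] : Prop :=
  ∀ a b c d : L, ⁅⁅a, b⁆, ⁅c, d⁆⁆ = 0

section Semidomains

variable (k : Type u) (L : Type v) [CommRing k] [LieRing L] [LieAlgebra k L]

/-- The commutant `L²`: the ideal generated by all products `a ∘ b`. -/
def commutant : LieIdeal k L :=
  LieSubmodule.lieSpan k L {z : L | ∃ a b : L, ⁅a, b⁆ = z}

/-- The Fitting radical: the ideal generated by all elements of nilpotent ideals of `L`.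
An ideal is nilpotent if it is nilpotent as a Lie algebra in its own right. -/
def fittingRadical : LieIdeal k L :=
  LieSubmodule.lieSpan k L {x : L | ∃ I : LieIdeal k L, LieRing.IsNilpotent I ∧ x ∈ I}

variable {L} in
/-- The principal ideal `⟨x⟩` generated by `x`. -/
def principalIdeal (x : L) : LieIdeal k L :=
  LieSubmodule.lieSpan k L {x}

variable {L} in
/-- A nonzero element `x` is a zero divisor if `⟨x⟩ ∘ ⟨y⟩ = 0` for some nonzero `y`. -/
def IsZeroDivisor (x : L) : Prop :=
  x ≠ 0 ∧ ∃ y : L, y ≠ 0 ∧ ⁅principalIdeal k x, principalIdeal k y⁆ = (⊥ : LieIdeal k L)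

/-- `D(L)`: the set of all zero divisors of `L` together with `0`. -/
def zeroDivisors : Set L :=
  {x : L | IsZeroDivisor k x} ∪ {0}

/-- `L` is a semidomain if `D(L) = Fit(L)`. -/
def IsSemidomain : Prop :=
  zeroDivisors k L = (fittingRadical k L : Set L)

/-- `L` is a strict semidomain if `D(L) = L²`. -/
def IsStrictSemidomain : Prop :=
  zeroDivisors k L = (commutant k L : Set L)

end Semidomains

section Product

/-- The ideal of the free Lie algebra on `X` generated by the relators `R` together with
all values of the metabelian identity. -/
noncomputable def relatorIdeal (k : Type u) [CommRing k] (X : Type v) (R : Set (FreeLieAlgebra k X)) :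
    LieIdeal k (FreeLieAlgebra k X) :=
  LieSubmodule.lieSpan k (FreeLieAlgebra k X)
    (R ∪ {z | ∃ a b c d : FreeLieAlgebra k X, ⁅⁅a, b⁆, ⁅c, d⁆⁆ = z})

/-- The Lie algebra `⟨X | R⟩` presented by generators `X` and relators `R` in the variety
of all metabelian Lie algebras over `k`. -/
abbrev Presented (k : Type u) [CommRing k] (X : Type v) (R : Set (FreeLieAlgebra k X)) :
    Type (max u v) :=
  FreeLieAlgebra k X ⧸ relatorIdeal k X R

/-- All relations of `L` with respect to the generating system of all elements of `L`. -/
def relations (k : Type u) (L : Type v) [CommRing k] [LieRing L] [LieAlgebra k L] :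
    Set (FreeLieAlgebra k L) :=
  {r | FreeLieAlgebra.lift k (id : L → L) r = 0}

/-- The metabelian product `A ∗ B`: the generators and relations of `A` and those of `B`, on
disjoint alphabets, are put together to a presentation in the variety of metabelian
Lie algebras. -/
abbrev MetabelianProduct (k : Type u) (A : Type v) (B : Type w) [CommRing k]
    [LieRing A] [LieAlgebra k A] [LieRing B] [LieAlgebra k B] : Type (max u v w) :=
  Presented k (A ⊕ B)
    (FreeLieAlgebra.lift k (fun a : A => FreeLieAlgebra.of k (Sum.inl a : A ⊕ B)) ''
        relations k A ∪
      FreeLieAlgebra.lift k (fun b : B => FreeLieAlgebra.of k (Sum.inr b : A ⊕ B)) ''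
        relations k B)

end Product

end MetabelianLie

namespace MetabelianLie

open LieModule MvPolynomial TensorProduct

/-! ### Zero divisors and the commutant of a metabelian algebra -/

section Commutant

variable {k : Type*} {L : Type*} [Field k] [LieRing L] [LieAlgebra k L]

/-! Everything reduces to one condition, `CommutantTorsionFree`. For a metabelian algebra it is
equivalent to being abelian or a strict semidomain (`isLieAbelian_or_isStrictSemidomain_iff`). The
product P = A ∗ B is never abelian, and Fit(P) = P², as homomorphisms to the two-dimensional
nonabelian algebra show (`fittingRadical_metabelianProduct`). So P is a semidomain exactly when it
satisfies the condition, and it remains to see that P satisfies it iff A and B do.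

The condition passes to A and B because they are retracts of P. For the converse, P² is a module
over the polynomial ring in bases of A/A² and B/B². Let N be the ideal of P generated by A² and B²
(`sweepSup`). Three homomorphisms to split extensions of abelian algebras together separate the
elements of P². The first takes values in polynomials, sends [a,b] to -ab, and its kernel on P² is
exactly N (`mem_sweepSup_of_snd_poly`). The second takes values in A² ⊗ k[B/B²]; it kills the ideal
generated by B² and is injective on the one generated by A² (`sweep_eq_zero_of_snd_tensor`). The
third exchanges A and B.

An element x = a + b + w outside P², with w in P², acts on the first model as a nonzero linear form
and on the second as ad a ⊗ 1 + 1 ⊗ b. Both operators are injective, the latter by a degree argument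
(`eq_zero_of_rTensor_add_lTensor_eq_zero`). Hence if y in P² satisfies [x,y] = 0, all three images
of y vanish and y = 0. -/

theorem lie_mem_commutant (x y : L) : ⁅x, y⁆ ∈ commutant k L :=
  LieSubmodule.subset_lieSpan ⟨x, y, rfl⟩

theorem commutant_le_of_lie_mem {W : Submodule k L} (h : ∀ x y : L, ⁅x, y⁆ ∈ W) :
    (commutant k L).toSubmodule ≤ W := by
  let I : LieIdeal k L := { W with lie_mem := fun {x m} _ => h x m }
  have : commutant k L ≤ I := LieSubmodule.lieSpan_le.2 (by rintro _ ⟨a, b, rfl⟩; exact h a b)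
  exact this

theorem map_mem_commutant {L' : Type*} [LieRing L'] [LieAlgebra k L'] (f : L →ₗ⁅k⁆ L') {x : L}
    (hx : x ∈ commutant k L) : f x ∈ commutant k L' := by
  have : (commutant k L).toSubmodule ≤ (commutant k L').toSubmodule.comap (f : L →ₗ[k] L') :=
    commutant_le_of_lie_mem fun a b => by
      simpa using lie_mem_commutant (k := k) (f a) (f b)
  exact this hx

theorem map_eq_zero_of_mem_commutant {M : Type*} [AddCommGroup M] [Module k M] (f : L →ₗ[k] M)
    (h : ∀ x y : L, f ⁅x, y⁆ = 0) {x : L} (hx : x ∈ commutant k L) : f x = 0 := by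
  have : (commutant k L).toSubmodule ≤ LinearMap.ker f := commutant_le_of_lie_mem h
  exact this hx

theorem IsMetabelian.lie_lie_eq_zero (hL : IsMetabelian L) (x y : L) {c : L}
    (hc : c ∈ commutant k L) : ⁅⁅x, y⁆, c⁆ = 0 := by
  have := map_eq_zero_of_mem_commutant (toEnd k L L ⁅x, y⁆) (fun a b => hL x y a b) hc
  exact this

theorem IsMetabelian.lie_eq_zero (hL : IsMetabelian L) {c d : L} (hc : c ∈ commutant k L)
    (hd : d ∈ commutant k L) : ⁅c, d⁆ = 0 := by
  have := map_eq_zero_of_mem_commutant (toEnd k L L d)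
    (fun a b => by
      rw [toEnd_apply_apply, ← lie_skew, hL.lie_lie_eq_zero a b hd, neg_zero]) hc
  rw [← lie_skew, ← toEnd_apply_apply k L L, this, neg_zero]

theorem IsMetabelian.lie_comm (hL : IsMetabelian L) (x y : L) {c : L} (hc : c ∈ commutant k L) :
    ⁅x, ⁅y, c⁆⁆ = ⁅y, ⁅x, c⁆⁆ := by
  rw [leibniz_lie, hL.lie_lie_eq_zero x y hc, zero_add]

theorem IsMetabelian.exists_notMem_commutant [Nontrivial L] (hL : IsMetabelian L) :
    ∃ t : L, t ∉ commutant k L := by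
  by_contra! h
  obtain ⟨x, hx⟩ := exists_ne (0 : L)
  have h0 : ∀ x y : L, ⁅x, y⁆ = 0 := fun x y => hL.lie_eq_zero (h x) (h y)
  exact hx (map_eq_zero_of_mem_commutant LinearMap.id h0 (h x))

theorem mem_principalIdeal_self (x : L) : x ∈ principalIdeal k x :=
  LieSubmodule.subset_lieSpan rfl

theorem lie_eq_zero_of_principalIdeal_lie {x y z : L}
    (h : ⁅principalIdeal k x, principalIdeal k y⁆ = (⊥ : LieIdeal k L))
    (hz : z ∈ principalIdeal k y) : ⁅x, z⁆ = 0 := by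
  have := LieSubmodule.lie_mem_lie (mem_principalIdeal_self (k := k) x) hz
  rwa [h, LieSubmodule.mem_bot] at this

/-- Adjoint operators commute on `L²`, so the annihilator of `x` in `L²` is an ideal and contains
⟨y⟩. The centralizer of the ideal ⟨y⟩ is again an ideal, so it contains ⟨x⟩. Thus one vanishing
bracket already gives a zero divisor. -/
theorem IsMetabelian.principalIdeal_lie_eq_bot (hL : IsMetabelian L) {x y : L}
    (hy : y ∈ commutant k L) (h : ⁅x, y⁆ = 0) :
    ⁅principalIdeal k x, principalIdeal k y⁆ = (⊥ : LieIdeal k L) := by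
  let I : LieIdeal k L :=
    { (commutant k L).toSubmodule ⊓ LinearMap.ker (toEnd k L L x) with
      lie_mem := by
        rintro z m ⟨hm, hm'⟩
        refine ⟨lie_mem_commutant _ _, ?_⟩
        have hm' : ⁅x, m⁆ = 0 := hm'
        change ⁅x, ⁅z, m⁆⁆ = 0
        rw [hL.lie_comm x z hm, hm', lie_zero] }
  have hI : principalIdeal k y ≤ I :=
    LieSubmodule.lieSpan_le.2 (by rintro _ rfl; exact ⟨hy, h⟩)
  let J : LieIdeal k L :=
    { carrier := {u | ∀ z ∈ principalIdeal k y, ⁅u, z⁆ = 0}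
      add_mem' := fun {a b} ha hb z hz => by rw [add_lie, ha z hz, hb z hz, add_zero]
      zero_mem' := fun z _ => zero_lie z
      smul_mem' := fun c u hu z hz => by rw [smul_lie, hu z hz, smul_zero]
      lie_mem := by
        intro v u hu z hz
        rw [lie_lie, hu z hz, lie_zero, zero_sub, neg_eq_zero]
        exact hu _ (LieSubmodule.lie_mem _ hz) }
  have hJ : principalIdeal k x ≤ J :=
    LieSubmodule.lieSpan_le.2 (by rintro _ rfl; exact fun z hz => (hI hz).2)
  rw [LieSubmodule.lie_eq_bot_iff]
  exact fun u hu z hz => hJ hu z hz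

theorem IsMetabelian.commutant_subset_zeroDivisors (hL : IsMetabelian L) :
    (commutant k L : Set L) ⊆ zeroDivisors k L := by
  intro x hx
  by_cases h0 : x = 0
  · exact Or.inr h0
  · exact Or.inl ⟨h0, x, h0, hL.principalIdeal_lie_eq_bot hx (lie_self x)⟩

theorem IsMetabelian.commutant_le_fittingRadical (hL : IsMetabelian L) :
    commutant k L ≤ fittingRadical k L := by
  intro x hx
  refine LieSubmodule.subset_lieSpan ⟨commutant k L, ?_, hx⟩
  have : LieModule.IsTrivial (commutant k L) (commutant k L) :=
    ⟨fun a b => Subtype.ext (hL.lie_eq_zero a.2 b.2)⟩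
  exact LieModule.trivialIsNilpotent _ _

variable (k L) in
/-- No element outside the commutant annihilates a nonzero element of the commutant. -/
def CommutantTorsionFree : Prop :=
  ∀ x ∉ commutant k L, ∀ y ∈ commutant k L, ⁅x, y⁆ = 0 → y = 0

theorem CommutantTorsionFree.isStrictSemidomain (hL : IsMetabelian L)
    (h : CommutantTorsionFree k L) (hab : ¬ IsLieAbelian L) : IsStrictSemidomain k L := by
  refine Set.Subset.antisymm ?_ hL.commutant_subset_zeroDivisors
  rintro x (⟨-, y, hy, hxy⟩ | rfl)
  · by_contra hx
    -- The bracket lies both in ⟨y⟩, which `x` annihilates, and in `L²`. So `y` is central, and if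
    -- it is outside `L²` it kills all of `L²`, which makes `L` abelian.
    have hcen : ∀ p : L, ⁅y, p⁆ = 0 := fun p =>
      h x hx _ (lie_mem_commutant _ _) (lie_eq_zero_of_principalIdeal_lie hxy
        (lie_mem_left k L _ _ _ (mem_principalIdeal_self y)))
    by_cases hyc : y ∈ commutant k L
    · exact hy (h x hx y hyc (lie_eq_zero_of_principalIdeal_lie hxy (mem_principalIdeal_self y)))
    · exact hab ⟨fun a b => h y hyc _ (lie_mem_commutant a b) (hcen _)⟩
  · exact zero_mem (commutant k L)

theorem IsStrictSemidomain.commutantTorsionFree (hL : IsMetabelian L)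
    (h : IsStrictSemidomain k L) : CommutantTorsionFree k L := by
  intro x hx y hy hxy
  by_contra hy0
  refine hx ?_
  rw [← SetLike.mem_coe, ← h]
  refine Or.inl ⟨?_, y, hy0, hL.principalIdeal_lie_eq_bot hy hxy⟩
  rintro rfl
  exact hx (zero_mem _)

theorem isLieAbelian_or_isStrictSemidomain_iff (hL : IsMetabelian L) :
    IsLieAbelian L ∨ IsStrictSemidomain k L ↔ CommutantTorsionFree k L := by
  constructor
  · rintro (h | h)
    · intro x _ y hy _
      exact map_eq_zero_of_mem_commutant LinearMap.id (fun a b => h.trivial a b) hy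
    · exact h.commutantTorsionFree hL
  · intro h
    by_cases hab : IsLieAbelian L
    · exact Or.inl hab
    · exact Or.inr (h.isStrictSemidomain hL hab)

theorem exists_pow_toEnd_eq_zero_of_mem_nilpotent {I : LieIdeal k L} (hI : LieRing.IsNilpotent I)
    {x : L} (hx : x ∈ I) : ∃ n : ℕ, ∀ y : L, ((toEnd k L L x) ^ n) y = 0 := by
  obtain ⟨n, hn⟩ := LieModule.isNilpotent_toEnd_of_isNilpotent k I I ⟨x, hx⟩
  -- The extra application of ad x carries `y` into `I`, where ad x is nilpotent.
  refine ⟨n + 1, fun y => ?_⟩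
  have key : ∀ (m : ℕ) (z : I), ((toEnd k L L x) ^ m) (z : L) =
      (((toEnd k I I ⟨x, hx⟩) ^ m) z : I) := by
    intro m
    induction m with
    | zero => intro z; rfl
    | succ m ih =>
      intro z
      rw [pow_succ, pow_succ, Module.End.mul_apply, Module.End.mul_apply, ← ih]
      rfl
  have h := key n ⟨⁅x, y⁆, lie_mem_left k L I x y hx⟩
  rw [hn] at h
  rw [pow_succ, Module.End.mul_apply]
  exact h

end Commutant

/-! ### Split extensions of an abelian algebra by an abelian ideal -/

section SplitExtension

variable {k R M : Type*} [Field k] [CommRing R] [Algebra k R] [AddCommGroup M] [Module k M]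

/-- The split extension of the abelian Lie algebra `R` by the abelian ideal `M`, on which
`R` acts through `ρ`. -/
@[ext]
structure SplitExtension (_ρ : R →ₐ[k] Module.End k M) where
  fst : R
  snd : M

namespace SplitExtension

variable {ρ : R →ₐ[k] Module.End k M}

/-- The underlying pair of an element of a split extension. -/
def toProd (x : SplitExtension ρ) : R × M := (x.fst, x.snd)

theorem toProd_injective : Function.Injective (toProd (ρ := ρ)) := fun x y h => by
  simp only [toProd, Prod.mk.injEq] at h
  exact SplitExtension.ext h.1 h.2

instance : Zero (SplitExtension ρ) := ⟨⟨0, 0⟩⟩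
instance : Add (SplitExtension ρ) := ⟨fun x y => ⟨x.fst + y.fst, x.snd + y.snd⟩⟩
instance : Neg (SplitExtension ρ) := ⟨fun x => ⟨-x.fst, -x.snd⟩⟩
instance : Sub (SplitExtension ρ) := ⟨fun x y => ⟨x.fst - y.fst, x.snd - y.snd⟩⟩
instance {T : Type*} [SMul T R] [SMul T M] : SMul T (SplitExtension ρ) :=
  ⟨fun c x => ⟨c • x.fst, c • x.snd⟩⟩

instance : AddCommGroup (SplitExtension ρ) :=
  toProd_injective.addCommGroup toProd rfl (fun _ _ => rfl) (fun _ => rfl) (fun _ _ => rfl)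
    (fun _ _ => rfl) (fun _ _ => rfl)

instance : Module k (SplitExtension ρ) :=
  toProd_injective.module k ⟨⟨toProd, rfl⟩, fun _ _ => rfl⟩ (fun _ _ => rfl)

instance : Bracket (SplitExtension ρ) (SplitExtension ρ) :=
  ⟨fun x y => ⟨0, ρ x.fst y.snd - ρ y.fst x.snd⟩⟩

@[simp] theorem fst_zero : (0 : SplitExtension ρ).fst = 0 := rfl
@[simp] theorem snd_zero : (0 : SplitExtension ρ).snd = 0 := rfl
@[simp] theorem fst_add (x y : SplitExtension ρ) : (x + y).fst = x.fst + y.fst := rfl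
@[simp] theorem snd_add (x y : SplitExtension ρ) : (x + y).snd = x.snd + y.snd := rfl
@[simp] theorem fst_smul (c : k) (x : SplitExtension ρ) : (c • x).fst = c • x.fst := rfl
@[simp] theorem snd_smul (c : k) (x : SplitExtension ρ) : (c • x).snd = c • x.snd := rfl
@[simp] theorem fst_lie (x y : SplitExtension ρ) : ⁅x, y⁆.fst = 0 := rfl
@[simp] theorem snd_lie (x y : SplitExtension ρ) :
    ⁅x, y⁆.snd = ρ x.fst y.snd - ρ y.fst x.snd := rfl

theorem apply_comm (r s : R) (m : M) : ρ r (ρ s m) = ρ s (ρ r m) := by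
  rw [← Module.End.mul_apply, ← map_mul, mul_comm, map_mul, Module.End.mul_apply]

instance : LieRing (SplitExtension ρ) where
  add_lie x y z := by
    ext
    · simp
    · simp only [snd_lie, fst_add, snd_add, map_add, LinearMap.add_apply]; abel
  lie_add x y z := by
    ext
    · simp
    · simp only [snd_lie, fst_add, snd_add, map_add, LinearMap.add_apply]; abel
  lie_self x := by
    ext
    · simp
    · simp
  leibniz_lie x y z := by
    ext
    · simp
    · simp only [snd_lie, snd_add, fst_lie, map_sub, map_zero, LinearMap.zero_apply]
      rw [apply_comm x.fst y.fst z.snd, apply_comm z.fst x.fst, apply_comm z.fst y.fst]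
      abel

instance : LieAlgebra k (SplitExtension ρ) where
  lie_smul c x y := by
    ext
    · simp
    · simp [smul_sub]

theorem isMetabelian (ρ : R →ₐ[k] Module.End k M) : IsMetabelian (SplitExtension ρ) := by
  intro a b c d
  ext
  · rfl
  · rw [snd_lie, fst_lie, fst_lie, map_zero, LinearMap.zero_apply, LinearMap.zero_apply,
      sub_zero, snd_zero]

variable (ρ) in
/-- The projection to the acting algebra. -/
def fstₗ : SplitExtension ρ →ₗ[k] R where
  toFun := fst
  map_add' _ _ := rfl
  map_smul' _ _ := rfl

variable (ρ) in
/-- The projection to the abelian ideal, as a linear map. -/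
def sndₗ : SplitExtension ρ →ₗ[k] M where
  toFun := snd
  map_add' _ _ := rfl
  map_smul' _ _ := rfl

theorem fst_eq_zero_of_mem_commutant {x : SplitExtension ρ}
    (hx : x ∈ commutant k (SplitExtension ρ)) : x.fst = 0 :=
  map_eq_zero_of_mem_commutant (fstₗ ρ) (fun _ _ => rfl) hx

variable {L : Type*} [LieRing L] [LieAlgebra k L]

/-- A homomorphism to the split extension from a linear map `f` vanishing on products and a
derivation `d`. -/
def homMk (f : L →ₗ[k] R) (d : L →ₗ[k] M) (hf : ∀ x y : L, f ⁅x, y⁆ = 0)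
    (hd : ∀ x y : L, d ⁅x, y⁆ = ρ (f x) (d y) - ρ (f y) (d x)) : L →ₗ⁅k⁆ SplitExtension ρ where
  toFun x := ⟨f x, d x⟩
  map_add' x y := by ext <;> simp
  map_smul' c x := by ext <;> simp
  map_lie' {x y} := by
    ext
    · simp [hf]
    · simp [hd]

@[simp] theorem fst_homMk (f : L →ₗ[k] R) (d : L →ₗ[k] M) (hf hd) (x : L) :
    (homMk (ρ := ρ) f d hf hd x).fst = f x := rfl
@[simp] theorem snd_homMk (f : L →ₗ[k] R) (d : L →ₗ[k] M) (hf hd) (x : L) :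
    (homMk (ρ := ρ) f d hf hd x).snd = d x := rfl

theorem fst_map_eq_zero (φ : L →ₗ⁅k⁆ SplitExtension ρ) {x : L} (hx : x ∈ commutant k L) :
    (φ x).fst = 0 :=
  fst_eq_zero_of_mem_commutant (map_mem_commutant φ hx)

/-- Restricted to the commutant, such a homomorphism turns ad x into the action of a ring element.
This transports annihilation from `L²` to a module. -/
theorem snd_map_lie (φ : L →ₗ⁅k⁆ SplitExtension ρ) (x : L) {y : L} (hy : y ∈ commutant k L) :
    (φ ⁅x, y⁆).snd = ρ (φ x).fst (φ y).snd := by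
  rw [LieHom.map_lie, snd_lie, fst_map_eq_zero φ hy, map_zero, LinearMap.zero_apply, sub_zero]

end SplitExtension

end SplitExtension

/-! ### The commutant as a module over a polynomial ring -/

section Action

variable {k : Type*} {L : Type*} [Field k] [LieRing L] [LieAlgebra k L]

-- Commuting operators generate a commutative subalgebra, where polynomials can be evaluated.
open scoped IsMulCommutative in
theorem exists_algHom_of_commute {ι M : Type*} [AddCommGroup M] [Module k M]
    (f : ι → Module.End k M) (h : ∀ i j, f i * f j = f j * f i) :
    ∃ ρ : MvPolynomial ι k →ₐ[k] Module.End k M, ∀ i, ρ (X i) = f i := by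
  have hc : ∀ a ∈ Set.range f, ∀ b ∈ Set.range f, a * b = b * a := by
    rintro _ ⟨i, rfl⟩ _ ⟨j, rfl⟩
    exact h i j
  have := Algebra.isMulCommutative_adjoin k hc
  let g : ι → Algebra.adjoin k (Set.range f) := fun i => ⟨f i, Algebra.subset_adjoin ⟨i, rfl⟩⟩
  refine ⟨(Algebra.adjoin k (Set.range f)).val.comp (aeval g), fun i => ?_⟩
  rw [AlgHom.comp_apply, aeval_X]
  rfl

theorem IsMetabelian.toEnd_mul_comm (hL : IsMetabelian L) (x y : L) :
    toEnd k L (commutant k L) x * toEnd k L (commutant k L) y =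
      toEnd k L (commutant k L) y * toEnd k L (commutant k L) x := by
  ext c
  exact hL.lie_comm x y c.2

theorem IsMetabelian.toEnd_eq_zero (hL : IsMetabelian L) {x : L} (hx : x ∈ commutant k L) :
    toEnd k L (commutant k L) x = 0 := by
  ext c
  exact hL.lie_eq_zero hx c.2

/-- The action of polynomials on the commutant of a metabelian Lie algebra, the variables acting
as the adjoint operators of given elements. -/
noncomputable def actionHom (hL : IsMetabelian L) {ι : Type*} (g : ι → L) :
    MvPolynomial ι k →ₐ[k] Module.End k (commutant k L) :=
  (exists_algHom_of_commute (fun i => toEnd k L (commutant k L) (g i))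
    fun _ _ => hL.toEnd_mul_comm _ _).choose

@[simp] theorem actionHom_X (hL : IsMetabelian L) {ι : Type*} (g : ι → L) (i : ι) :
    actionHom (k := k) hL g (X i) = toEnd k L (commutant k L) (g i) :=
  (exists_algHom_of_commute (fun i => toEnd k L (commutant k L) (g i))
    fun _ _ => hL.toEnd_mul_comm _ _).choose_spec i

theorem toEnd_actionHom (hL : IsMetabelian L) {ι : Type*} (g : ι → L) (x : L)
    (s : MvPolynomial ι k) (c : commutant k L) :
    toEnd k L (commutant k L) x (actionHom hL g s c) =
      actionHom hL g s (toEnd k L (commutant k L) x c) := by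
  induction s using MvPolynomial.induction_on generalizing c with
  | C a => rw [← algebraMap_eq, AlgHom.commutes]; simp
  | add p q hp hq => rw [map_add, LinearMap.add_apply, map_add, hp, hq, LinearMap.add_apply]
  | mul_X p i hp =>
    rw [map_mul, Module.End.mul_apply, Module.End.mul_apply, hp, actionHom_X]
    congr 1
    exact LinearMap.congr_fun (hL.toEnd_mul_comm x (g i)) c

theorem snd_map_actionHom {R M : Type*} [CommRing R] [Algebra k R] [AddCommGroup M] [Module k M]
    {ρ : R →ₐ[k] Module.End k M} (hL : IsMetabelian L) (φ : L →ₗ⁅k⁆ SplitExtension ρ)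
    {ι : Type*} (g : ι → L) (s : MvPolynomial ι k) (c : commutant k L) :
    (φ (actionHom hL g s c : commutant k L)).snd =
      ρ (aeval (fun i => (φ (g i)).fst) s) (φ c).snd := by
  induction s using MvPolynomial.induction_on generalizing c with
  | C a =>
    rw [← algebraMap_eq, AlgHom.commutes, AlgHom.commutes, AlgHom.commutes]
    simp
  | add p q hp hq => simp [hp, hq]
  | mul_X p i hp =>
    rw [map_mul, Module.End.mul_apply, hp, actionHom_X, map_mul, map_mul, Module.End.mul_apply,
      aeval_X]
    congr 1
    exact SplitExtension.snd_map_lie φ (g i) c.2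

variable (k L) in
/-- The index type of a basis of the abelianization. -/
abbrev AbelianizationIndex : Type _ := Module.Basis.ofVectorSpaceIndex k (L ⧸ commutant k L)

variable (k L) in
/-- A basis of the abelianization. -/
noncomputable def abelianizationBasis :
    Module.Basis (AbelianizationIndex k L) k (L ⧸ commutant k L) :=
  Module.Basis.ofVectorSpace k (L ⧸ commutant k L)

variable (k L) in
/-- Elements lifting the basis of the abelianization. -/
noncomputable def gen (i : AbelianizationIndex k L) : L :=
  (LieSubmodule.Quotient.surjective_mk' (commutant k L) (abelianizationBasis k L i)).choose

variable (k L) in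
/-- The coordinates of an element in the abelianization, as a linear form in variables. -/
noncomputable def linForm : L →ₗ[k] MvPolynomial (AbelianizationIndex k L) k :=
  (Finsupp.linearCombination k X ∘ₗ (abelianizationBasis k L).repr.toLinearMap) ∘ₗ
    (LieSubmodule.Quotient.mk' (commutant k L) : L →ₗ[k] L ⧸ commutant k L)

theorem mk'_gen (i : AbelianizationIndex k L) :
    LieSubmodule.Quotient.mk' (commutant k L) (gen k L i) = abelianizationBasis k L i :=
  (LieSubmodule.Quotient.surjective_mk' (commutant k L) (abelianizationBasis k L i)).choose_spec

@[simp] theorem linForm_gen (i : AbelianizationIndex k L) : linForm k L (gen k L i) = X i := by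
  change Finsupp.linearCombination k X ((abelianizationBasis k L).repr
    (LieSubmodule.Quotient.mk' (commutant k L) (gen k L i))) = _
  rw [mk'_gen]
  simp

theorem coeff_linearCombination_X {ι : Type*} (v : ι →₀ k) (i : ι) :
    coeff (Finsupp.single i 1) (Finsupp.linearCombination k (X : ι → MvPolynomial ι k) v) = v i := by
  classical
  induction v using Finsupp.induction_linear with
  | zero => simp
  | add f g hf hg => simp [hf, hg]
  | single j a => simp [coeff_X, Finsupp.single_apply, Finsupp.single_left_inj]

theorem linForm_eq_zero_iff (a : L) : linForm k L a = 0 ↔ a ∈ commutant k L := by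
  rw [← LieSubmodule.Quotient.mk_eq_zero]
  change Finsupp.linearCombination k X ((abelianizationBasis k L).repr
    (LieSubmodule.Quotient.mk' (commutant k L) a)) = 0 ↔ _
  constructor
  · intro h
    rw [← (abelianizationBasis k L).repr.map_eq_zero_iff]
    ext i
    rw [← coeff_linearCombination_X, h]
    simp
  · intro h
    rw [h, map_zero, map_zero]

@[simp] theorem linForm_lie (a b : L) : linForm k L ⁅a, b⁆ = 0 :=
  (linForm_eq_zero_iff _).2 (lie_mem_commutant a b)

theorem constantCoeff_linForm (a : L) : constantCoeff (linForm k L a) = 0 := by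
  change constantCoeff (Finsupp.linearCombination k X ((abelianizationBasis k L).repr
    (LieSubmodule.Quotient.mk' (commutant k L) a))) = 0
  generalize (abelianizationBasis k L).repr _ = v
  induction v using Finsupp.induction_linear with
  | zero => simp
  | add f g hf hg => simp [hf, hg]
  | single j a => simp [smul_eq_C_mul]

/-- A subspace which contains the commutant and the lifts of the basis is everything. -/
theorem mem_of_gen_mem {W : Submodule k L} (hgen : ∀ i, gen k L i ∈ W)
    (hcom : ∀ c ∈ commutant k L, c ∈ W) (a : L) : a ∈ W := by
  set v := (abelianizationBasis k L).repr (LieSubmodule.Quotient.mk' (commutant k L) a) with hv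
  have h1 : Finsupp.linearCombination k (gen k L) v ∈ W := by
    rw [Finsupp.linearCombination_apply]
    exact Submodule.sum_mem _ fun i _ => W.smul_mem _ (hgen i)
  have h2 : a - Finsupp.linearCombination k (gen k L) v ∈ commutant k L := by
    rw [← LieSubmodule.Quotient.mk_eq_zero, map_sub, sub_eq_zero]
    have := Finsupp.apply_linearCombination k
      (LieSubmodule.Quotient.mk' (commutant k L) : L →ₗ[k] L ⧸ commutant k L) (gen k L) v
    refine Eq.trans ?_ this.symm
    have e : (LieSubmodule.Quotient.mk' (commutant k L) : L →ₗ[k] L ⧸ commutant k L) ∘ gen k L =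
        abelianizationBasis k L := funext mk'_gen
    rw [e, hv, Module.Basis.linearCombination_repr]
  have := W.add_mem (hcom _ h2) h1
  rwa [sub_add_cancel] at this

/-- Both sides are linear in `a`, agree on the lifted basis, and vanish on the commutant of `L`,
whose image acts trivially on that of `P`. -/
theorem actionHom_linForm {P : Type*} [LieRing P] [LieAlgebra k P] (hP : IsMetabelian P)
    (i : L →ₗ⁅k⁆ P) {ι : Type*} (g : ι → P) (r : AbelianizationIndex k L → ι)
    (h : ∀ j, g (r j) = i (gen k L j)) (a : L) :
    actionHom hP g (rename r (linForm k L a)) = toEnd k P (commutant k P) (i a) := by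
  let F : L →ₗ[k] Module.End k (commutant k P) :=
    (actionHom hP g).toLinearMap ∘ₗ (rename r).toLinearMap ∘ₗ linForm k L -
      (toEnd k P (commutant k P) : P →ₗ[k] _) ∘ₗ (i : L →ₗ[k] P)
  have : a ∈ LinearMap.ker F := by
    refine mem_of_gen_mem (fun j => ?_) (fun c hc => ?_) a
    · change actionHom hP g (rename r (linForm k L (gen k L j))) -
        toEnd k P (commutant k P) (i (gen k L j)) = 0
      rw [linForm_gen, rename_X, actionHom_X, h, sub_self]
    · change actionHom hP g (rename r (linForm k L c)) - toEnd k P (commutant k P) (i c) = 0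
      rw [(linForm_eq_zero_iff c).2 hc, hP.toEnd_eq_zero (map_mem_commutant i hc), map_zero,
        map_zero, sub_self]
  exact sub_eq_zero.1 this

end Action

/-! ### Injectivity of f ⊗ 1 + 1 ⊗ s -/

section Tensor

variable {k : Type*} [Field k]

/-- A nonzero polynomial without constant term has positive degree, so for p ≠ 0 the degree of s ^ n
* p is at least n. -/
theorem eq_zero_of_totalDegree_pow_mul_le {τ : Type*} {s p : MvPolynomial τ k} (hs : s ≠ 0)
    (hs0 : constantCoeff s = 0) {D : ℕ} (h : ∀ n : ℕ, (s ^ n * p).totalDegree ≤ D) : p = 0 := by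
  by_contra hp
  have hd : 1 ≤ s.totalDegree := by
    by_contra! hlt
    have h0 : s.totalDegree = 0 := by omega
    rw [totalDegree_eq_zero_iff_eq_C] at h0
    rw [constantCoeff_eq] at hs0
    rw [hs0, map_zero] at h0
    exact hs h0
  have key : ∀ n : ℕ, n ≤ (s ^ n * p).totalDegree := by
    intro n
    induction n with
    | zero => exact Nat.zero_le _
    | succ n ih =>
      rw [pow_succ', mul_assoc,
        totalDegree_mul_of_isDomain hs (mul_ne_zero (pow_ne_zero n hs) hp)]
      omega
  have h1 := key (D + 1)
  have h2 := h (D + 1)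
  omega

variable {M τ : Type*} [AddCommGroup M] [Module k M]

/-- The contraction of the first tensor factor with a functional. -/
noncomputable def contract (S : Type*) [AddCommGroup S] [Module k S] (l : M →ₗ[k] k) :
    M ⊗[k] S →ₗ[k] S :=
  (TensorProduct.lid k S).toLinearMap ∘ₗ LinearMap.rTensor S l

@[simp] theorem contract_tmul {S : Type*} [AddCommGroup S] [Module k S] (l : M →ₗ[k] k) (m : M)
    (s : S) : contract S l (m ⊗ₜ s) = l m • s := by
  simp [contract]

theorem eq_zero_of_contract_eq_zero {S : Type*} [AddCommGroup S] [Module k S] (w : M ⊗[k] S)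
    (h : ∀ l : M →ₗ[k] k, contract S l w = 0) : w = 0 := by
  classical
  let b := Module.Basis.ofVectorSpace k M
  apply (TensorProduct.equivFinsuppOfBasisLeft (N := S) b).injective
  rw [map_zero]
  ext i
  rw [Finsupp.zero_apply, ← h (b.coord i)]
  induction w using TensorProduct.induction_on with
  | zero => simp
  | tmul m s => simp
  | add x y hx hy =>
    have hc : ∀ z : M ⊗[k] S, TensorProduct.equivFinsuppOfBasisLeft b z i =
        contract S (b.coord i) z := by
      intro z
      induction z using TensorProduct.induction_on with
      | zero => simp
      | tmul m s => simp
      | add x y hx hy => simp [hx, hy]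
    exact hc _

/-- The bound comes from the finitely many polynomials occurring in `w`. Its independence of the
functional is what makes the degree argument work. -/
theorem exists_totalDegree_contract_le (w : M ⊗[k] MvPolynomial τ k) :
    ∃ D : ℕ, ∀ l : M →ₗ[k] k, (contract (MvPolynomial τ k) l w).totalDegree ≤ D := by
  induction w using TensorProduct.induction_on with
  | zero => exact ⟨0, fun l => by simp⟩
  | tmul m s =>
    exact ⟨s.totalDegree, fun l => by rw [contract_tmul]; exact totalDegree_smul_le _ _⟩
  | add x y hx hy =>
    obtain ⟨D, hD⟩ := hx
    obtain ⟨E, hE⟩ := hy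
    refine ⟨max D E, fun l => ?_⟩
    rw [map_add]
    exact (totalDegree_add _ _).trans (max_le_max (hD l) (hE l))

theorem contract_rTensor {S : Type*} [AddCommGroup S] [Module k S] (f : Module.End k M)
    (l : M →ₗ[k] k) (w : M ⊗[k] S) :
    contract S l (LinearMap.rTensor S f w) = contract S (l ∘ₗ f) w := by
  induction w using TensorProduct.induction_on with
  | zero => simp
  | tmul m s => simp
  | add x y hx hy => simp [hx, hy]

theorem contract_lTensor {S : Type*} [AddCommGroup S] [Module k S] (g : Module.End k S)
    (l : M →ₗ[k] k) (w : M ⊗[k] S) :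
    contract S l (LinearMap.lTensor M g w) = g (contract S l w) := by
  induction w using TensorProduct.induction_on with
  | zero => simp
  | tmul m s => simp
  | add x y hx hy => simp [hx, hy]

/-- If `s` is a polynomial without constant term, and `s ≠ 0` or `f` is injective, then
`f ⊗ 1 + 1 ⊗ s` is injective. -/
theorem eq_zero_of_rTensor_add_lTensor_eq_zero (f : Module.End k M) (s : MvPolynomial τ k)
    (hs0 : constantCoeff s = 0) (h : s = 0 → Function.Injective f) (w : M ⊗[k] MvPolynomial τ k)
    (hw : LinearMap.rTensor _ f w + LinearMap.lTensor M (LinearMap.mulLeft k s) w = 0) :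
    w = 0 := by
  by_cases hs : s = 0
  · have hf := Module.Flat.rTensor_preserves_injective_linearMap (M := MvPolynomial τ k) f (h hs)
    apply hf
    rw [hs, LinearMap.mulLeft_zero_eq_zero, LinearMap.lTensor_zero, LinearMap.zero_apply,
      add_zero] at hw
    rw [hw, map_zero]
  · apply eq_zero_of_contract_eq_zero
    intro l
    obtain ⟨D, hD⟩ := exists_totalDegree_contract_le w
    refine eq_zero_of_totalDegree_pow_mul_le hs hs0 (D := D) fun n => ?_
    -- On `w`, multiplication by `s` equals -f ⊗ 1, so each factor `s` can be moved into the
    -- functional. The degrees thus stay below `D` for all `n`.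
    have key : ∀ l : M →ₗ[k] k, s ^ n * contract (MvPolynomial τ k) l w =
        contract (MvPolynomial τ k) (l ∘ₗ (-f) ^ n) w := by
      induction n with
      | zero =>
        intro l
        rw [pow_zero, pow_zero, one_mul, Module.End.one_eq_id, LinearMap.comp_id]
      | succ n ih =>
        intro l
        have h1 : s * contract (MvPolynomial τ k) l w =
            contract (MvPolynomial τ k) (l ∘ₗ (-f)) w := by
          have e1 := contract_lTensor (LinearMap.mulLeft k s) l w
          rw [LinearMap.mulLeft_apply] at e1
          rw [← e1, ← contract_rTensor, LinearMap.rTensor_neg, LinearMap.neg_apply,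
            eq_neg_of_add_eq_zero_right hw]
        rw [pow_succ, mul_assoc, h1, ih, LinearMap.comp_assoc, pow_succ', Module.End.mul_eq_comp]
    rw [key]
    exact hD _

end Tensor

/-! ### Exchange relations and factorization through X i X j -/

section Koszul

variable {k : Type*} [Field k] {σ τ Q : Type*} [AddCommGroup Q] [Module k Q]

theorem exists_eq_add_single {ι : Type*} {i j : ι} (hij : i ≠ j) {d e : ι →₀ ℕ}
    (h : d + Finsupp.single i 1 = e + Finsupp.single j 1) :
    ∃ g, d = g + Finsupp.single j 1 ∧ e = g + Finsupp.single i 1 := by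
  classical
  have hj : Finsupp.single j 1 ≤ d := by
    rw [Finsupp.single_le_iff]
    have := DFunLike.congr_fun h j
    simp only [Finsupp.add_apply, Finsupp.single_eq_same, Finsupp.single_eq_of_ne hij.symm] at this
    omega
  refine ⟨d - Finsupp.single j 1, (tsub_add_cancel_of_le hj).symm, ?_⟩
  rw [← tsub_add_cancel_of_le hj, add_right_comm] at h
  exact (add_right_cancel h).symm

variable (ρ : MvPolynomial (σ ⊕ τ) k →ₐ[k] Module.End k Q) (N : Submodule k Q)

/-- For i ≠ j the monomials are g X_j and g X_i, and g multiplies the given relation. For i = j no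
variable can be split off, hence the separate hypothesis `hq`. -/
theorem monomial_exchange (hN : ∀ s, ∀ q ∈ N, ρ s q ∈ N) {i j : σ ⊕ τ} {q q' : Q}
    (hq : i = j → q = q') (h : ρ (X j) q - ρ (X i) q' ∈ N) {d e : σ ⊕ τ →₀ ℕ}
    (hde : d + Finsupp.single i 1 = e + Finsupp.single j 1) :
    ρ (monomial d 1) q - ρ (monomial e 1) q' ∈ N := by
  by_cases hij : i = j
  · subst hij
    rw [add_right_cancel hde, hq rfl, sub_self]
    exact N.zero_mem
  · obtain ⟨g, rfl, rfl⟩ := exists_eq_add_single hij hde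
    have hm : ∀ l : σ ⊕ τ, monomial (g + Finsupp.single l 1) (1 : k) = monomial g 1 * X l := by
      intro l
      rw [X, monomial_mul, one_mul]
    rw [hm, hm, map_mul, map_mul, Module.End.mul_apply, Module.End.mul_apply, ← map_sub]
    exact hN _ _ h

/-- A family `c i j` satisfying `X i' c i j = X i c i' j` and `X j' c i j = X j c i j'` modulo
`N` factors modulo `N` through the products `X i X j`. -/
theorem exists_linearMap_of_exchange (c : σ → τ → Q) (hN : ∀ s, ∀ q ∈ N, ρ s q ∈ N)
    (hl : ∀ i i' j, ρ (X (Sum.inl i')) (c i j) - ρ (X (Sum.inl i)) (c i' j) ∈ N)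
    (hr : ∀ i j j', ρ (X (Sum.inr j')) (c i j) - ρ (X (Sum.inr j)) (c i j') ∈ N) :
    ∃ θ : MvPolynomial (σ ⊕ τ) k →ₗ[k] Q, ∀ s i j,
      θ (s * X (Sum.inl i) * X (Sum.inr j)) - ρ s (c i j) ∈ N := by
  classical
  -- `T d (e, i, j)` records a factorization X^d = X^e X_i X_j. The map θ will use an arbitrary one,
  -- and `hT` is its independence of that choice modulo `N`.
  let T : (σ ⊕ τ →₀ ℕ) → (σ ⊕ τ →₀ ℕ) × σ × τ → Prop := fun d t =>
    d = t.1 + Finsupp.single (Sum.inl t.2.1) 1 + Finsupp.single (Sum.inr t.2.2) 1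
  have hT : ∀ d t t', T d t → T d t' →
      ρ (monomial t.1 1) (c t.2.1 t.2.2) - ρ (monomial t'.1 1) (c t'.2.1 t'.2.2) ∈ N := by
    rintro d ⟨e, i, j⟩ ⟨e', i', j'⟩ rfl h
    simp only [T] at h ⊢
    by_cases hii : i = i'
    · subst hii
      refine monomial_exchange ρ N hN (i := Sum.inr j) (j := Sum.inr j') (fun h => ?_) (hr _ _ _) ?_
      · rw [Sum.inr_injective h]
      · apply add_right_cancel (b := Finsupp.single (Sum.inl i) 1)
        rw [add_right_comm, h, add_right_comm]
    -- Pass through the intermediate pair (i', j). This is possible because X_{i'} divides X^e: it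
    -- divides X^e X_j and differs from X_j.
    · have h' : e + Finsupp.single (Sum.inr j) 1 + Finsupp.single (Sum.inl i) 1 =
          e' + Finsupp.single (Sum.inr j') 1 + Finsupp.single (Sum.inl i') 1 := by
        rw [add_right_comm, h, add_right_comm]
      obtain ⟨g, hg, hg'⟩ := exists_eq_add_single (fun h => hii (Sum.inl_injective h)) h'
      have hii' : (Sum.inr j : σ ⊕ τ) ≠ Sum.inl i' := by simp
      have hle : Finsupp.single (Sum.inl i' : σ ⊕ τ) 1 ≤ e := by
        rw [Finsupp.single_le_iff]
        have := DFunLike.congr_fun hg (Sum.inl i')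
        simp only [Finsupp.add_apply, Finsupp.single_eq_same,
          Finsupp.single_eq_of_ne hii'.symm] at this
        omega
      obtain ⟨f, rfl⟩ : ∃ f, e = f + Finsupp.single (Sum.inl i') 1 :=
        ⟨_, (tsub_add_cancel_of_le hle).symm⟩
      have hgf : g = f + Finsupp.single (Sum.inr j) 1 := by
        rw [add_right_comm] at hg
        exact (add_right_cancel hg).symm
      have h1 : ρ (monomial (f + Finsupp.single (Sum.inl i') 1) 1) (c i j) -
          ρ (monomial (f + Finsupp.single (Sum.inl i) 1) 1) (c i' j) ∈ N :=
        monomial_exchange ρ N hN (i := Sum.inl i) (j := Sum.inl i')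
          (fun h => absurd (Sum.inl_injective h) hii) (hl _ _ _) (add_right_comm _ _ _)
      have h2 : ρ (monomial (f + Finsupp.single (Sum.inl i) 1) 1) (c i' j) -
          ρ (monomial e' 1) (c i' j') ∈ N := by
        refine monomial_exchange ρ N hN (i := Sum.inr j) (j := Sum.inr j') (fun h => ?_)
          (hr _ _ _) ?_
        · rw [Sum.inr_injective h]
        · rw [hg', hgf, add_right_comm]
      simpa using N.add_mem h1 h2
  -- Monomials divisible by no product X_i X_j never occur in the claim; their value 0 is arbitrary.
  let θ : MvPolynomial (σ ⊕ τ) k →ₗ[k] Q := (basisMonomials (σ ⊕ τ) k).constr k fun d =>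
    if h : ∃ t, T d t then ρ (monomial h.choose.1 1) (c h.choose.2.1 h.choose.2.2) else 0
  refine ⟨θ, fun s i j => ?_⟩
  let F : MvPolynomial (σ ⊕ τ) k →ₗ[k] Q :=
    θ ∘ₗ LinearMap.mulRight k (X (Sum.inl i) * X (Sum.inr j)) -
      ρ.toLinearMap.flip (c i j)
  have hF : ∀ s, F s = θ (s * X (Sum.inl i) * X (Sum.inr j)) - ρ s (c i j) := fun s => by
    simp [F, mul_assoc]
  rw [← hF]
  induction s using MvPolynomial.induction_on' with
  | add p q hp hq => rw [map_add]; exact N.add_mem hp hq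
  | monomial d a =>
    have : monomial d a = a • monomial d (1 : k) := by rw [smul_monomial, smul_eq_mul, mul_one]
    rw [this, map_smul]
    refine N.smul_mem _ ?_
    rw [hF, X, X, monomial_mul, monomial_mul, one_mul, one_mul]
    have hex : ∃ t, T (d + Finsupp.single (Sum.inl i) 1 + Finsupp.single (Sum.inr j) 1) t :=
      ⟨(d, i, j), rfl⟩
    have hθ : θ (monomial (d + Finsupp.single (Sum.inl i) 1 + Finsupp.single (Sum.inr j) 1) 1) =
        ρ (monomial hex.choose.1 1) (c hex.choose.2.1 hex.choose.2.2) := by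
      refine ((basisMonomials (σ ⊕ τ) k).constr_basis k _ _).trans ?_
      exact dif_pos hex
    rw [hθ]
    exact hT _ _ (d, i, j) hex.choose_spec rfl

end Koszul

/-! ### The ideal of P generated by the commutant of one factor -/

section Sweep

variable {k A B P : Type*} [Field k] [LieRing A] [LieAlgebra k A] [LieRing B] [LieAlgebra k B]
  [LieRing P] [LieAlgebra k P]

/-- The restriction of a homomorphism to the commutants. -/
def commutantMap (i : A →ₗ⁅k⁆ P) : commutant k A →ₗ[k] commutant k P where
  toFun m := ⟨i m, map_mem_commutant i m.2⟩
  map_add' x y := Subtype.ext (by simp)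
  map_smul' c x := Subtype.ext (by simp)

@[simp] theorem coe_commutantMap (i : A →ₗ⁅k⁆ P) (m : commutant k A) :
    (commutantMap i m : P) = i m := rfl

/-- The map `m ⊗ s ↦ s • m` from `A² ⊗ k[B / B²]` to the commutant of `P`. -/
noncomputable def sweep (hP : IsMetabelian P) (i : A →ₗ⁅k⁆ P) (j : B →ₗ⁅k⁆ P) :
    commutant k A ⊗[k] MvPolynomial (AbelianizationIndex k B) k →ₗ[k] commutant k P :=
  TensorProduct.lift ((actionHom hP (j ∘ gen k B)).toLinearMap.flip ∘ₗ commutantMap i)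

variable (hP : IsMetabelian P) (i : A →ₗ⁅k⁆ P) (j : B →ₗ⁅k⁆ P)

@[simp] theorem sweep_tmul (m : commutant k A) (s : MvPolynomial (AbelianizationIndex k B) k) :
    sweep hP i j (m ⊗ₜ s) = actionHom hP (j ∘ gen k B) s (commutantMap i m) := by
  simp [sweep]

theorem actionHom_linForm_comp (b : B) :
    actionHom hP (j ∘ gen k B) (linForm k B b) = toEnd k P (commutant k P) (j b) := by
  have := actionHom_linForm hP j (j ∘ gen k B) id (fun _ => rfl) b
  rwa [rename_id_apply] at this

/-- The action of `a` commutes past polynomials in elements of `B` and reaches the factor A², where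
it is ad a. -/
theorem toEnd_sweep_left (a : A)
    (w : commutant k A ⊗[k] MvPolynomial (AbelianizationIndex k B) k) :
    toEnd k P (commutant k P) (i a) (sweep hP i j w) =
      sweep hP i j (LinearMap.rTensor _ (toEnd k A (commutant k A) a) w) := by
  induction w using TensorProduct.induction_on with
  | zero => simp
  | tmul m s =>
    rw [sweep_tmul, LinearMap.rTensor_tmul, sweep_tmul, toEnd_actionHom]
    congr 1
    exact Subtype.ext (i.map_lie a m).symm
  | add x y hx hy => rw [map_add, map_add, hx, hy, map_add, map_add]

theorem toEnd_sweep_right (b : B)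
    (w : commutant k A ⊗[k] MvPolynomial (AbelianizationIndex k B) k) :
    toEnd k P (commutant k P) (j b) (sweep hP i j w) =
      sweep hP i j (LinearMap.lTensor _ (LinearMap.mulLeft k (linForm k B b)) w) := by
  induction w using TensorProduct.induction_on with
  | zero => simp
  | tmul m s =>
    rw [sweep_tmul, LinearMap.lTensor_tmul, sweep_tmul, LinearMap.mulLeft_apply, map_mul,
      actionHom_linForm_comp, Module.End.mul_apply]
  | add x y hx hy => rw [map_add, map_add, hx, hy, map_add, map_add]

theorem commutantMap_mem_range_sweep (m : commutant k A) :
    commutantMap i m ∈ LinearMap.range (sweep hP i j) :=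
  ⟨m ⊗ₜ 1, by rw [sweep_tmul, map_one, Module.End.one_apply]⟩

end Sweep

/-! ### Generation of P² by the commutants of the factors and mixed products -/

section Generation

variable {k A B P : Type*} [Field k] [LieRing A] [LieAlgebra k A] [LieRing B] [LieAlgebra k B]
  [LieRing P] [LieAlgebra k P] {i : A →ₗ⁅k⁆ P} {j : B →ₗ⁅k⁆ P}

/-- The product of an element of `A` and an element of `B`, in the commutant of `P`. -/
def mixedLie (i : A →ₗ⁅k⁆ P) (j : B →ₗ⁅k⁆ P) : A →ₗ[k] B →ₗ[k] commutant k P :=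
  LinearMap.mk₂ k (fun a b => ⟨⁅i a, j b⁆, lie_mem_commutant _ _⟩)
    (fun _ _ _ => Subtype.ext (by simp)) (fun _ _ _ => Subtype.ext (by simp))
    (fun _ _ _ => Subtype.ext (by simp)) (fun _ _ _ => Subtype.ext (by simp))

@[simp] theorem coe_mixedLie (a : A) (b : B) : (mixedLie i j a b : P) = ⁅i a, j b⁆ := rfl

/-- The sums i A + j B + W form a subalgebra containing the generators: expanding a bracket gives
values of `i` and `j`, mixed products, and terms in which `W` is acted upon. -/
theorem exists_eq_add_add_of_mixedLie_mem (hP : IsMetabelian P)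
    (hgen : LieSubalgebra.lieSpan k P (Set.range i ∪ Set.range j) = ⊤)
    (W : Submodule k (commutant k P)) (hi : ∀ a, ∀ w ∈ W, toEnd k P (commutant k P) (i a) w ∈ W)
    (hj : ∀ b, ∀ w ∈ W, toEnd k P (commutant k P) (j b) w ∈ W)
    (hij : ∀ a b, mixedLie i j a b ∈ W) (p : P) : ∃ a b, ∃ w ∈ W, p = i a + j b + w := by
  let K : LieSubalgebra k P :=
    { carrier := {p | ∃ a b, ∃ w ∈ W, p = i a + j b + w}
      add_mem' := by
        rintro _ _ ⟨a, b, w, hw, rfl⟩ ⟨a', b', w', hw', rfl⟩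
        refine ⟨a + a', b + b', w + w', W.add_mem hw hw', ?_⟩
        simp only [map_add, LieSubmodule.coe_add]
        abel
      zero_mem' := ⟨0, 0, 0, W.zero_mem, by simp⟩
      smul_mem' := by
        rintro c _ ⟨a, b, w, hw, rfl⟩
        refine ⟨c • a, c • b, c • w, W.smul_mem c hw, ?_⟩
        simp only [map_smul, LieSubmodule.coe_smul, smul_add]
      lie_mem' := by
        rintro _ _ ⟨a, b, w, hw, rfl⟩ ⟨a', b', w', hw', rfl⟩
        refine ⟨⁅a, a'⁆, ⁅b, b'⁆, mixedLie i j a b' - mixedLie i j a' b +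
          (toEnd k P (commutant k P) (i a) w' + toEnd k P (commutant k P) (j b) w') -
          (toEnd k P (commutant k P) (i a') w + toEnd k P (commutant k P) (j b') w), ?_, ?_⟩
        · exact W.sub_mem (W.add_mem (W.sub_mem (hij _ _) (hij _ _))
            (W.add_mem (hi _ _ hw') (hj _ _ hw'))) (W.add_mem (hi _ _ hw) (hj _ _ hw))
        · have h0 : ⁅(w : P), (w' : P)⁆ = 0 := hP.lie_eq_zero w.2 w'.2
          simp only [LieSubmodule.coe_sub, LieSubmodule.coe_add, coe_mixedLie, toEnd_apply_apply,
            LieSubmodule.coe_bracket, LieHom.map_lie, add_lie, lie_add, h0]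
          rw [← lie_skew (j b) (i a'), ← lie_skew (w : P) (i a'), ← lie_skew (w : P) (j b')]
          abel }
  have hK : LieSubalgebra.lieSpan k P (Set.range i ∪ Set.range j) ≤ K := by
    rw [LieSubalgebra.lieSpan_le]
    rintro _ (⟨a, rfl⟩ | ⟨b, rfl⟩)
    · exact ⟨a, 0, 0, W.zero_mem, by simp⟩
    · exact ⟨0, b, 0, W.zero_mem, by simp⟩
  rw [hgen] at hK
  exact hK (LieSubalgebra.mem_top p)

theorem exists_eq_add_add (hP : IsMetabelian P)
    (hgen : LieSubalgebra.lieSpan k P (Set.range i ∪ Set.range j) = ⊤) (p : P) :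
    ∃ a b, ∃ w ∈ commutant k P, p = i a + j b + w := by
  obtain ⟨a, b, w, -, h⟩ := exists_eq_add_add_of_mixedLie_mem hP hgen ⊤ (fun _ _ _ => trivial)
    (fun _ _ _ => trivial) (fun _ _ => trivial) p
  exact ⟨a, b, w, w.2, h⟩

variable (i j) in
/-- The ideal of `P` generated by the commutants of `A` and of `B`. -/
noncomputable def sweepSup (hP : IsMetabelian P) : Submodule k (commutant k P) :=
  LinearMap.range (sweep hP i j) ⊔ LinearMap.range (sweep hP j i)

theorem toEnd_left_mem_sweepSup (hP : IsMetabelian P) (a : A) {w : commutant k P}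
    (hw : w ∈ sweepSup i j hP) : toEnd k P (commutant k P) (i a) w ∈ sweepSup i j hP := by
  obtain ⟨_, ⟨u, rfl⟩, _, ⟨v, rfl⟩, rfl⟩ := Submodule.mem_sup.1 hw
  rw [map_add, toEnd_sweep_left, toEnd_sweep_right]
  exact Submodule.add_mem_sup ⟨_, rfl⟩ ⟨_, rfl⟩

theorem toEnd_right_mem_sweepSup (hP : IsMetabelian P) (b : B) {w : commutant k P}
    (hw : w ∈ sweepSup i j hP) : toEnd k P (commutant k P) (j b) w ∈ sweepSup i j hP := by
  obtain ⟨_, ⟨u, rfl⟩, _, ⟨v, rfl⟩, rfl⟩ := Submodule.mem_sup.1 hw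
  rw [map_add, toEnd_sweep_left, toEnd_sweep_right]
  exact Submodule.add_mem_sup ⟨_, rfl⟩ ⟨_, rfl⟩

variable (i j) in
/-- The lifts of the bases of both abelianizations. -/
noncomputable def sumGen : AbelianizationIndex k A ⊕ AbelianizationIndex k B → P :=
  Sum.elim (i ∘ gen k A) (j ∘ gen k B)

theorem actionHom_sumGen_left (hP : IsMetabelian P) (a : A) :
    actionHom hP (sumGen i j) (rename Sum.inl (linForm k A a)) =
      toEnd k P (commutant k P) (i a) :=
  actionHom_linForm hP i (sumGen i j) Sum.inl (fun _ => rfl) a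

theorem actionHom_sumGen_right (hP : IsMetabelian P) (b : B) :
    actionHom hP (sumGen i j) (rename Sum.inr (linForm k B b)) =
      toEnd k P (commutant k P) (j b) :=
  actionHom_linForm hP j (sumGen i j) Sum.inr (fun _ => rfl) b

theorem actionHom_mem_sweepSup (hP : IsMetabelian P)
    (s : MvPolynomial (AbelianizationIndex k A ⊕ AbelianizationIndex k B) k) {w : commutant k P}
    (hw : w ∈ sweepSup i j hP) : actionHom hP (sumGen i j) s w ∈ sweepSup i j hP := by
  induction s using MvPolynomial.induction_on generalizing w with
  | C a =>
    rw [← algebraMap_eq, AlgHom.commutes, Module.algebraMap_end_apply]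
    exact Submodule.smul_mem _ _ hw
  | add p q hp hq => rw [map_add]; exact Submodule.add_mem _ (hp hw) (hq hw)
  | mul_X p l hp =>
    rw [map_mul, Module.End.mul_apply, actionHom_X]
    apply hp
    rcases l with l | l
    · exact toEnd_left_mem_sweepSup hP _ hw
    · exact toEnd_right_mem_sweepSup hP _ hw

theorem mixedLie_mem_sweepSup_left (hP : IsMetabelian P) {a : A} (ha : a ∈ commutant k A) (b : B) :
    mixedLie i j a b ∈ sweepSup i j hP := by
  have h : mixedLie i j a b = -toEnd k P (commutant k P) (j b) (commutantMap i ⟨a, ha⟩) :=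
    Subtype.ext (lie_skew (i a) (j b)).symm
  rw [h]
  exact Submodule.neg_mem _ (toEnd_right_mem_sweepSup hP _
    (Submodule.mem_sup_left (commutantMap_mem_range_sweep hP i j _)))

theorem mixedLie_mem_sweepSup_right (hP : IsMetabelian P) (a : A) {b : B}
    (hb : b ∈ commutant k B) : mixedLie i j a b ∈ sweepSup i j hP :=
  toEnd_left_mem_sweepSup hP a (w := commutantMap j ⟨b, hb⟩)
    (Submodule.mem_sup_right (commutantMap_mem_range_sweep hP j i _))

variable (i j) in
/-- The subspace spanned by `sweepSup` and all multiples of mixed products. -/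
noncomputable def mixedSpan (hP : IsMetabelian P) : Submodule k (commutant k P) :=
  sweepSup i j hP ⊔ Submodule.span k
    {y | ∃ s a b, actionHom hP (sumGen i j) s (mixedLie i j a b) = y}

theorem actionHom_mem_mixedSpan (hP : IsMetabelian P)
    (s : MvPolynomial (AbelianizationIndex k A ⊕ AbelianizationIndex k B) k) {w : commutant k P}
    (hw : w ∈ mixedSpan i j hP) : actionHom hP (sumGen i j) s w ∈ mixedSpan i j hP := by
  have : mixedSpan i j hP ≤ (mixedSpan i j hP).comap (actionHom hP (sumGen i j) s) := by
    refine sup_le (fun y hy => ?_) (Submodule.span_le.2 ?_)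
    · exact Submodule.mem_sup_left (actionHom_mem_sweepSup hP s hy)
    · rintro _ ⟨t, a, b, rfl⟩
      refine Submodule.mem_sup_right (Submodule.subset_span ⟨s * t, a, b, ?_⟩)
      rw [map_mul, Module.End.mul_apply]
  exact this hw

theorem mixedLie_mem_mixedSpan (hP : IsMetabelian P) (a : A) (b : B) :
    mixedLie i j a b ∈ mixedSpan i j hP :=
  Submodule.mem_sup_right (Submodule.subset_span ⟨1, a, b, by rw [map_one, Module.End.one_apply]⟩)

/-- Every element of P has the form i a + j b + w with w in `mixedSpan`, and the bracket of two such
elements expands into terms of `mixedSpan`. -/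
theorem mixedSpan_eq_top (hP : IsMetabelian P)
    (hgen : LieSubalgebra.lieSpan k P (Set.range i ∪ Set.range j) = ⊤) :
    mixedSpan i j hP = ⊤ := by
  have hi : ∀ a, ∀ w ∈ mixedSpan i j hP,
      toEnd k P (commutant k P) (i a) w ∈ mixedSpan i j hP := fun a w hw => by
    rw [← actionHom_sumGen_left (j := j)]; exact actionHom_mem_mixedSpan hP _ hw
  have hj : ∀ b, ∀ w ∈ mixedSpan i j hP,
      toEnd k P (commutant k P) (j b) w ∈ mixedSpan i j hP := fun b w hw => by
    rw [← actionHom_sumGen_right (i := i)]; exact actionHom_mem_mixedSpan hP _ hw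
  have hdec := exists_eq_add_add_of_mixedLie_mem hP hgen _ hi hj (mixedLie_mem_mixedSpan hP)
  have hcA : ∀ m, commutantMap i m ∈ mixedSpan i j hP := fun m =>
    Submodule.mem_sup_left (Submodule.mem_sup_left (commutantMap_mem_range_sweep hP i j m))
  have hcB : ∀ m, commutantMap j m ∈ mixedSpan i j hP := fun m =>
    Submodule.mem_sup_left (Submodule.mem_sup_right (commutantMap_mem_range_sweep hP j i m))
  have hle : (commutant k P).toSubmodule ≤
      (mixedSpan i j hP).map (commutant k P).toSubmodule.subtype := by
    refine commutant_le_of_lie_mem fun p q => ?_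
    obtain ⟨a, b, w, hw, rfl⟩ := hdec p
    obtain ⟨a', b', w', hw', rfl⟩ := hdec q
    refine ⟨commutantMap i ⟨⁅a, a'⁆, lie_mem_commutant _ _⟩ +
      commutantMap j ⟨⁅b, b'⁆, lie_mem_commutant _ _⟩ +
      (mixedLie i j a b' - mixedLie i j a' b +
        (toEnd k P (commutant k P) (i a) w' + toEnd k P (commutant k P) (j b) w') -
        (toEnd k P (commutant k P) (i a') w + toEnd k P (commutant k P) (j b') w)), ?_, ?_⟩
    · exact Submodule.add_mem _ (Submodule.add_mem _ (hcA _) (hcB _))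
        (Submodule.sub_mem _ (Submodule.add_mem _ (Submodule.sub_mem _
          (mixedLie_mem_mixedSpan hP _ _) (mixedLie_mem_mixedSpan hP _ _))
          (Submodule.add_mem _ (hi _ _ hw') (hj _ _ hw')))
          (Submodule.add_mem _ (hi _ _ hw) (hj _ _ hw)))
    · have h0 : ⁅(w : P), (w' : P)⁆ = 0 := hP.lie_eq_zero w.2 w'.2
      simp only [Submodule.subtype_apply, LieSubmodule.coe_sub, LieSubmodule.coe_add,
        coe_mixedLie, coe_commutantMap, toEnd_apply_apply, LieSubmodule.coe_bracket,
        LieHom.map_lie, add_lie, lie_add, h0]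
      rw [← lie_skew (j b) (i a'), ← lie_skew (w : P) (i a'), ← lie_skew (w : P) (j b')]
      abel
  rw [eq_top_iff]
  intro y _
  obtain ⟨z, hz, hzy⟩ := hle y.2
  rwa [← Subtype.ext hzy]

/-- The quotient of the commutant by `sweepSup` is a factor of the polynomial ring. -/
theorem exists_linearMap_mixedLie (hP : IsMetabelian P) :
    ∃ θ : MvPolynomial (AbelianizationIndex k A ⊕ AbelianizationIndex k B) k →ₗ[k] commutant k P,
      ∀ s a b, θ (s * rename Sum.inl (linForm k A a) * rename Sum.inr (linForm k B b)) -
        actionHom hP (sumGen i j) s (mixedLie i j a b) ∈ sweepSup i j hP := by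
  obtain ⟨θ, hθ⟩ := exists_linearMap_of_exchange (actionHom hP (sumGen i j)) (sweepSup i j hP)
    (fun l m => mixedLie i j (gen k A l) (gen k B m))
    (fun s q hq => actionHom_mem_sweepSup hP s hq)
    (by
      intro l l' m
      -- By Jacobi the defect of the exchange relation is a mixed product with a factor in A², so it
      -- lies in `sweepSup`. The second exchange relation is the same for B².
      have h : actionHom hP (sumGen i j) (X (Sum.inl l')) (mixedLie i j (gen k A l) (gen k B m)) -
          actionHom hP (sumGen i j) (X (Sum.inl l)) (mixedLie i j (gen k A l') (gen k B m)) =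
          mixedLie i j ⁅gen k A l', gen k A l⁆ (gen k B m) := by
        rw [actionHom_X, actionHom_X]
        refine Subtype.ext ?_
        simp [sumGen, lie_lie]
      rw [h]
      exact mixedLie_mem_sweepSup_left hP (lie_mem_commutant _ _) _)
    (by
      intro l m m'
      have h : actionHom hP (sumGen i j) (X (Sum.inr m')) (mixedLie i j (gen k A l) (gen k B m)) -
          actionHom hP (sumGen i j) (X (Sum.inr m)) (mixedLie i j (gen k A l) (gen k B m')) =
          mixedLie i j (gen k A l) ⁅gen k B m', gen k B m⁆ := by
        rw [actionHom_X, actionHom_X]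
        refine Subtype.ext ?_
        change ⁅j (gen k B m'), ⁅i (gen k A l), j (gen k B m)⁆⁆ -
          ⁅j (gen k B m), ⁅i (gen k A l), j (gen k B m')⁆⁆ =
          ⁅i (gen k A l), j ⁅gen k B m', gen k B m⁆⁆
        rw [LieHom.map_lie, leibniz_lie (i (gen k A l)),
          ← lie_skew ⁅i (gen k A l), j (gen k B m')⁆]
        abel
      rw [h]
      exact mixedLie_mem_sweepSup_right hP _ (lie_mem_commutant _ _))
  refine ⟨θ, fun s a b => ?_⟩
  let F : A →ₗ[k] B →ₗ[k] commutant k P :=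
    LinearMap.mk₂ k (fun a b =>
      θ (s * rename Sum.inl (linForm k A a) * rename Sum.inr (linForm k B b)) -
        actionHom hP (sumGen i j) s (mixedLie i j a b))
      (fun _ _ _ => by simp only [map_add, mul_add, add_mul, LinearMap.add_apply]; abel)
      (fun _ _ _ => by
        simp only [map_smul, mul_smul_comm, smul_mul_assoc, LinearMap.smul_apply, smul_sub])
      (fun _ _ _ => by simp only [map_add, mul_add]; abel)
      (fun _ _ _ => by simp only [map_smul, mul_smul_comm, smul_sub])
  have hF : ∀ a b, F a b =
      θ (s * rename Sum.inl (linForm k A a) * rename Sum.inr (linForm k B b)) -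
        actionHom hP (sumGen i j) s (mixedLie i j a b) := fun _ _ => rfl
  rw [← hF]
  -- By bilinearity it suffices to take lifted basis elements, or one argument in a commutant: there
  -- the linear form vanishes and the mixed product is in `sweepSup`.
  refine mem_of_gen_mem (W := (sweepSup i j hP).comap (F.flip b)) (fun l => ?_) (fun c hc => ?_) a
  · refine mem_of_gen_mem (W := (sweepSup i j hP).comap (F (gen k A l))) (fun m => ?_)
      (fun c hc => ?_) b
    · rw [Submodule.mem_comap, hF, linForm_gen, linForm_gen, rename_X, rename_X]
      exact hθ s l m
    · rw [Submodule.mem_comap, hF, (linForm_eq_zero_iff c).2 hc, map_zero, mul_zero, map_zero,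
        zero_sub]
      exact Submodule.neg_mem _ (actionHom_mem_sweepSup hP s (mixedLie_mem_sweepSup_right hP _ hc))
  · rw [Submodule.mem_comap, LinearMap.flip_apply, hF, (linForm_eq_zero_iff c).2 hc, map_zero,
      mul_zero, zero_mul, map_zero, zero_sub]
    exact Submodule.neg_mem _ (actionHom_mem_sweepSup hP s (mixedLie_mem_sweepSup_left hP hc _))

end Generation

/-! ### The model A² ⊗ k[B/B²], detecting the ideal generated by A² -/

section TensorModel

variable {k A B P : Type*} [Field k] [LieRing A] [LieAlgebra k A] [LieRing B] [LieAlgebra k B]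
  [LieRing P] [LieAlgebra k P]

variable (k B) in
/-- The action of `k[A / A²] ⊗ k[B / B²]` on `A² ⊗ k[B / B²]`. -/
noncomputable def tensorAction (hA : IsMetabelian A) :
    MvPolynomial (AbelianizationIndex k A) k ⊗[k] MvPolynomial (AbelianizationIndex k B) k →ₐ[k]
      Module.End k (commutant k A ⊗[k] MvPolynomial (AbelianizationIndex k B) k) :=
  (Module.endTensorEndAlgHom (R := k) (A := k) (M := commutant k A)
      (N := MvPolynomial (AbelianizationIndex k B) k)).comp
    (Algebra.TensorProduct.map (actionHom hA (gen k A))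
      (Algebra.lmul k (MvPolynomial (AbelianizationIndex k B) k)))

theorem tensorAction_tmul (hA : IsMetabelian A) (s : MvPolynomial (AbelianizationIndex k A) k)
    (p : MvPolynomial (AbelianizationIndex k B) k) :
    tensorAction k B hA (s ⊗ₜ p) =
      TensorProduct.map (actionHom hA (gen k A) s) (LinearMap.mulLeft k p) := by
  rfl

theorem actionHom_gen_linForm (hA : IsMetabelian A) (a : A) :
    actionHom hA (gen k A) (linForm k A a) = toEnd k A (commutant k A) a :=
  actionHom_linForm_comp hA (LieHom.id : A →ₗ⁅k⁆ A) a

theorem tensorAction_left (hA : IsMetabelian A) (a : A) :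
    tensorAction k B hA (linForm k A a ⊗ₜ 1) =
      LinearMap.rTensor _ (toEnd k A (commutant k A) a) := by
  rw [tensorAction_tmul, actionHom_gen_linForm, LinearMap.mulLeft_one]
  rfl

theorem tensorAction_right (hA : IsMetabelian A) (p : MvPolynomial (AbelianizationIndex k B) k) :
    tensorAction k B hA (1 ⊗ₜ p) = LinearMap.lTensor _ (LinearMap.mulLeft k p) := by
  rw [tensorAction_tmul, map_one]
  rfl

/-- The derivation `ad t`, with values in the commutant. -/
def adCommutant (t : A) : A →ₗ[k] commutant k A where
  toFun a := ⟨⁅t, a⁆, lie_mem_commutant t a⟩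
  map_add' _ _ := Subtype.ext (by simp)
  map_smul' _ _ := Subtype.ext (by simp)

variable (k B) in
/-- The homomorphism from `A` to the split extension of `tensorAction` given by `ad t`. -/
noncomputable def tensorLeft (hA : IsMetabelian A) (t : A) :
    A →ₗ⁅k⁆ SplitExtension (tensorAction k B hA) :=
  SplitExtension.homMk ((TensorProduct.mk k _ _).flip 1 ∘ₗ linForm k A)
    ((TensorProduct.mk k _ _).flip 1 ∘ₗ adCommutant t)
    (fun x y => by simp)
    (fun x y => by
      simp only [LinearMap.comp_apply, LinearMap.flip_apply, TensorProduct.mk_apply,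
        tensorAction_left, LinearMap.rTensor_tmul, ← TensorProduct.sub_tmul]
      congr 1
      refine Subtype.ext ?_
      change ⁅t, ⁅x, y⁆⁆ = ⁅x, ⁅t, y⁆⁆ - ⁅y, ⁅t, x⁆⁆
      rw [leibniz_lie, ← lie_skew ⁅t, x⁆ y]
      abel)

variable (k B) in
/-- The homomorphism from `B` to the acting algebra of `tensorAction`. -/
noncomputable def tensorRight (hA : IsMetabelian A) :
    B →ₗ⁅k⁆ SplitExtension (tensorAction k B hA) :=
  SplitExtension.homMk (TensorProduct.mk k _ _ 1 ∘ₗ linForm k B) 0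
    (fun x y => by simp) (fun x y => by simp)

variable {hA : IsMetabelian A} {i : A →ₗ⁅k⁆ P} {j : B →ₗ⁅k⁆ P} {t : A}
  {φ : P →ₗ⁅k⁆ SplitExtension (tensorAction k B hA)}

/-- In this model `x` acts as ad a ⊗ 1 + 1 ⊗ b. If the linear form of `b` vanishes, then `a` is
outside A² and ad a is injective on A² by hypothesis. -/
theorem snd_tensor_eq_zero (hφi : ∀ a, φ (i a) = tensorLeft k B hA t a)
    (hφj : ∀ b, φ (j b) = tensorRight k B hA b) (hTF : CommutantTorsionFree k A) {a : A} {b : B}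
    {x : P} (hab : a ∉ commutant k A ∨ b ∉ commutant k B) {w y : P} (hw : w ∈ commutant k P)
    (hx : x = i a + j b + w) (hy : y ∈ commutant k P) (hxy : ⁅x, y⁆ = 0) : (φ y).snd = 0 := by
  have h := SplitExtension.snd_map_lie φ x hy
  have hfst : (φ x).fst = linForm k A a ⊗ₜ 1 + 1 ⊗ₜ linForm k B b := by
    rw [hx, map_add, map_add, SplitExtension.fst_add, SplitExtension.fst_add,
      SplitExtension.fst_map_eq_zero φ hw, hφi, hφj, add_zero]
    rfl
  rw [hxy, map_zero, SplitExtension.snd_zero, hfst, map_add, tensorAction_left,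
    tensorAction_right, LinearMap.add_apply] at h
  refine eq_zero_of_rTensor_add_lTensor_eq_zero _ _ (constantCoeff_linForm b) (fun hb => ?_) _
    h.symm
  rw [linForm_eq_zero_iff] at hb
  have ha := hab.resolve_right (not_not.2 hb)
  rw [← LinearMap.ker_eq_bot, LinearMap.ker_eq_bot']
  intro m hm
  exact Subtype.ext (hTF a ha m m.2 (congrArg Subtype.val hm))

theorem aeval_fst_tensorRight (s : MvPolynomial (AbelianizationIndex k B) k) :
    aeval (fun l => (tensorRight k B hA (gen k B l)).fst) s =
      (1 : MvPolynomial (AbelianizationIndex k A) k) ⊗ₜ[k] s := by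
  have : aeval (fun l => (tensorRight k B hA (gen k B l)).fst) =
      (Algebra.TensorProduct.includeRight :
        MvPolynomial (AbelianizationIndex k B) k →ₐ[k]
          MvPolynomial (AbelianizationIndex k A) k ⊗[k] _) := by
    refine MvPolynomial.algHom_ext fun l => ?_
    rw [aeval_X, Algebra.TensorProduct.includeRight_apply, ← linForm_gen]
    rfl
  rw [this, Algebra.TensorProduct.includeRight_apply]

/-- The identity of A² need not extend to a derivation A → A², whereas ad t is one on all of A. The
price is a twist by ad t ⊗ 1, harmless once ad t is injective on A². -/
theorem snd_tensor_sweep (hP : IsMetabelian P) (hφi : ∀ a, φ (i a) = tensorLeft k B hA t a)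
    (hφj : ∀ b, φ (j b) = tensorRight k B hA b)
    (w : commutant k A ⊗[k] MvPolynomial (AbelianizationIndex k B) k) :
    (φ (sweep hP i j w : commutant k P)).snd =
      LinearMap.rTensor _ (toEnd k A (commutant k A) t) w := by
  induction w using TensorProduct.induction_on with
  | zero => simp
  | tmul m s =>
    rw [sweep_tmul, snd_map_actionHom]
    simp only [Function.comp_apply, hφj]
    rw [aeval_fst_tensorRight, tensorAction_right, coe_commutantMap, hφi]
    change LinearMap.lTensor _ (LinearMap.mulLeft k s) (adCommutant t (m : A) ⊗ₜ 1) = _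
    rw [LinearMap.lTensor_tmul, LinearMap.rTensor_tmul, LinearMap.mulLeft_apply, mul_one]
    rfl
  | add x y hx hy => simp [hx, hy]

theorem sweep_eq_zero_of_snd_tensor (hP : IsMetabelian P)
    (hφi : ∀ a, φ (i a) = tensorLeft k B hA t a) (hφj : ∀ b, φ (j b) = tensorRight k B hA b)
    (hTF : CommutantTorsionFree k A) (ht : t ∉ commutant k A)
    {w : commutant k A ⊗[k] MvPolynomial (AbelianizationIndex k B) k}
    (h : (φ (sweep hP i j w : commutant k P)).snd = 0) : sweep hP i j w = 0 := by
  rw [snd_tensor_sweep hP hφi hφj] at h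
  have hinj : Function.Injective (toEnd k A (commutant k A) t) := by
    rw [← LinearMap.ker_eq_bot, LinearMap.ker_eq_bot']
    intro m hm
    exact Subtype.ext (hTF t ht m m.2 (congrArg Subtype.val hm))
  have := Module.Flat.rTensor_preserves_injective_linearMap
    (M := MvPolynomial (AbelianizationIndex k B) k) _ hinj
  rw [this (h.trans (map_zero _).symm), map_zero]

/-- `B` maps into the acting algebra with zero module component, so everything generated by B² dies.
-/
theorem snd_tensor_sweep_swap (hP : IsMetabelian P) (hφj : ∀ b, φ (j b) = tensorRight k B hA b)
    (w : commutant k B ⊗[k] MvPolynomial (AbelianizationIndex k A) k) :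
    (φ (sweep hP j i w : commutant k P)).snd = 0 := by
  induction w using TensorProduct.induction_on with
  | zero => simp
  | tmul m s =>
    rw [sweep_tmul, snd_map_actionHom, coe_commutantMap, hφj]
    exact map_zero _
  | add x y hx hy => simp [hx, hy]

end TensorModel

/-! ### The polynomial model, detecting P² modulo the commutants of the factors -/

section PolynomialModel

variable {k : Type*} (A B : Type*) {P : Type*} [Field k] [LieRing A] [LieAlgebra k A] [LieRing B]
  [LieAlgebra k B] [LieRing P] [LieAlgebra k P]

variable (k) in
/-- The regular action of the polynomial ring on the basis elements of both abelianizations. -/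
noncomputable abbrev polyAction :=
  Algebra.lmul k (MvPolynomial (AbelianizationIndex k A ⊕ AbelianizationIndex k B) k)

variable (k) in
/-- The homomorphism `a ↦ (a, a)` to the polynomial split extension. -/
noncomputable def polyLeft : A →ₗ⁅k⁆ SplitExtension (polyAction k A B) :=
  SplitExtension.homMk ((rename Sum.inl).toLinearMap ∘ₗ linForm k A)
    ((rename Sum.inl).toLinearMap ∘ₗ linForm k A)
    (fun x y => by simp)
    (fun x y => by
      change rename Sum.inl (linForm k A ⁅x, y⁆) =
        rename Sum.inl (linForm k A x) * rename Sum.inl (linForm k A y) -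
          rename Sum.inl (linForm k A y) * rename Sum.inl (linForm k A x)
      rw [linForm_lie, map_zero, mul_comm, sub_self])

variable (k) in
/-- The homomorphism `b ↦ (b, 0)` to the polynomial split extension. -/
noncomputable def polyRight : B →ₗ⁅k⁆ SplitExtension (polyAction k A B) :=
  SplitExtension.homMk ((rename Sum.inr).toLinearMap ∘ₗ linForm k B) 0
    (fun x y => by simp) (fun x y => by simp)

variable {A B} {i : A →ₗ⁅k⁆ P} {j : B →ₗ⁅k⁆ P} {φ : P →ₗ⁅k⁆ SplitExtension (polyAction k A B)}

/-- Setting one group of variables to zero isolates each form, as neither has a constant term. -/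
theorem rename_add_rename_eq_zero {a : A} {b : B}
    (h : rename (Sum.inl : _ → AbelianizationIndex k A ⊕ AbelianizationIndex k B) (linForm k A a) +
      rename Sum.inr (linForm k B b) = 0) : a ∈ commutant k A ∧ b ∈ commutant k B := by
  have h1 := congrArg (aeval (Sum.elim (X : _ → MvPolynomial (AbelianizationIndex k A) k)
    (fun _ => 0))) h
  have h2 := congrArg (aeval (Sum.elim (fun _ => 0)
    (X : _ → MvPolynomial (AbelianizationIndex k B) k))) h
  rw [map_add, aeval_rename, aeval_rename, Sum.elim_comp_inl, Sum.elim_comp_inr, aeval_X_left,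
    map_zero] at h1 h2
  constructor
  · rw [aeval_zero', constantCoeff_linForm b, map_zero, add_zero] at h1
    exact (linForm_eq_zero_iff a).1 h1
  · rw [aeval_zero', constantCoeff_linForm a, map_zero, zero_add] at h2
    exact (linForm_eq_zero_iff b).1 h2

theorem snd_poly_eq_zero (hφi : ∀ a, φ (i a) = polyLeft k A B a)
    (hφj : ∀ b, φ (j b) = polyRight k A B b) {a : A} {b : B}
    {x : P} (hab : a ∉ commutant k A ∨ b ∉ commutant k B) {w y : P} (hw : w ∈ commutant k P)
    (hx : x = i a + j b + w) (hy : y ∈ commutant k P) (hxy : ⁅x, y⁆ = 0) : (φ y).snd = 0 := by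
  have h := SplitExtension.snd_map_lie φ x hy
  have hfst : (φ x).fst = rename Sum.inl (linForm k A a) + rename Sum.inr (linForm k B b) := by
    rw [hx, map_add, map_add, SplitExtension.fst_add, SplitExtension.fst_add,
      SplitExtension.fst_map_eq_zero φ hw, hφi, hφj, add_zero]
    rfl
  rw [hxy, map_zero, SplitExtension.snd_zero, hfst] at h
  refine (mul_eq_zero.1 (Eq.symm h)).resolve_left fun h0 => ?_
  have := rename_add_rename_eq_zero h0
  tauto

theorem aeval_fst_sumGen (hφi : ∀ a, φ (i a) = polyLeft k A B a)
    (hφj : ∀ b, φ (j b) = polyRight k A B b)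
    (s : MvPolynomial (AbelianizationIndex k A ⊕ AbelianizationIndex k B) k) :
    aeval (fun l => (φ (sumGen i j l)).fst) s = s := by
  have : (fun l => (φ (sumGen i j l)).fst) = X := by
    funext l
    rcases l with l | l
    · change (φ (i (gen k A l))).fst = _
      rw [hφi]
      change rename Sum.inl (linForm k A (gen k A l)) = _
      rw [linForm_gen, rename_X]
    · change (φ (j (gen k B l))).fst = _
      rw [hφj]
      change rename Sum.inr (linForm k B (gen k B l)) = _
      rw [linForm_gen, rename_X]
  rw [this, aeval_X_left_apply]

theorem snd_poly_sweepSup (hP : IsMetabelian P) (hφi : ∀ a, φ (i a) = polyLeft k A B a)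
    (hφj : ∀ b, φ (j b) = polyRight k A B b) {y : commutant k P} (hy : y ∈ sweepSup i j hP) :
    (φ y).snd = 0 := by
  have hA : ∀ w, (φ (sweep hP i j w : commutant k P)).snd = 0 := by
    intro w
    induction w using TensorProduct.induction_on with
    | zero => simp
    | tmul m s =>
      rw [sweep_tmul, snd_map_actionHom, coe_commutantMap, hφi]
      change _ * rename Sum.inl (linForm k A m) = 0
      rw [(linForm_eq_zero_iff _).2 m.2, map_zero, mul_zero]
    | add x y hx hy => simp [hx, hy]
  have hB : ∀ w, (φ (sweep hP j i w : commutant k P)).snd = 0 := by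
    intro w
    induction w using TensorProduct.induction_on with
    | zero => simp
    | tmul m s =>
      rw [sweep_tmul, snd_map_actionHom, coe_commutantMap, hφj]
      exact map_zero _
    | add x y hx hy => simp [hx, hy]
  obtain ⟨_, ⟨u, rfl⟩, _, ⟨v, rfl⟩, rfl⟩ := Submodule.mem_sup.1 hy
  rw [LieSubmodule.coe_add, map_add, SplitExtension.snd_add, hA, hB, add_zero]

theorem snd_poly_mixedLie (hφi : ∀ a, φ (i a) = polyLeft k A B a)
    (hφj : ∀ b, φ (j b) = polyRight k A B b) (a : A) (b : B) :
    (φ (mixedLie i j a b : commutant k P)).snd =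
      -(rename Sum.inl (linForm k A a) * rename Sum.inr (linForm k B b)) := by
  rw [coe_mixedLie, LieHom.map_lie, hφi, hφj, SplitExtension.snd_lie]
  change rename Sum.inl (linForm k A a) * 0 -
    rename Sum.inr (linForm k B b) * rename Sum.inl (linForm k A a) = _
  ring

/-- The map θ of `exists_linearMap_mixedLie` inverts the model modulo `sweepSup`, up to sign. -/
theorem mem_sweepSup_of_snd_poly (hP : IsMetabelian P)
    (hgen : LieSubalgebra.lieSpan k P (Set.range i ∪ Set.range j) = ⊤)
    (hφi : ∀ a, φ (i a) = polyLeft k A B a) (hφj : ∀ b, φ (j b) = polyRight k A B b)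
    {y : commutant k P} (hy : (φ y).snd = 0) : y ∈ sweepSup i j hP := by
  obtain ⟨θ, hθ⟩ := exists_linearMap_mixedLie (i := i) (j := j) hP
  -- The identity is added, not subtracted, because the model sends s[a,b] to -sab. So `F` maps all
  -- of P² into `sweepSup`, and F y = y when the image of `y` vanishes.
  let F : commutant k P →ₗ[k] commutant k P :=
    θ ∘ₗ SplitExtension.sndₗ (polyAction k A B) ∘ₗ (φ : P →ₗ[k] _) ∘ₗ
      (commutant k P).toSubmodule.subtype + LinearMap.id
  have hF : ∀ y, F y = θ (φ y).snd + y := fun _ => rfl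
  have hle : mixedSpan i j hP ≤ (sweepSup i j hP).comap F := by
    refine sup_le (fun y hy => ?_) (Submodule.span_le.2 ?_)
    · rw [Submodule.mem_comap, hF, snd_poly_sweepSup hP hφi hφj hy, map_zero, zero_add]
      exact hy
    · rintro _ ⟨s, a, b, rfl⟩
      rw [SetLike.mem_coe, Submodule.mem_comap, hF, snd_map_actionHom,
        aeval_fst_sumGen hφi hφj, snd_poly_mixedLie hφi hφj]
      change θ (s * _) + _ ∈ _
      rw [mul_neg, map_neg, ← mul_assoc, neg_add_eq_sub, ← neg_sub]
      exact Submodule.neg_mem _ (hθ s a b)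
  rw [mixedSpan_eq_top hP hgen] at hle
  have := hle (Submodule.mem_top (x := y))
  rwa [Submodule.mem_comap, hF, hy, map_zero, zero_add] at this

end PolynomialModel

/-! ### Torsion-freeness of the product from the three models -/

section Main

variable {k A B P : Type*} [Field k] [LieRing A] [LieAlgebra k A] [LieRing B] [LieAlgebra k B]
  [LieRing P] [LieAlgebra k P] {hA : IsMetabelian A} {hB : IsMetabelian B}

theorem commutantTorsionFree_of_homs (hP : IsMetabelian P) {i : A →ₗ⁅k⁆ P} {j : B →ₗ⁅k⁆ P}
    (hgen : LieSubalgebra.lieSpan k P (Set.range i ∪ Set.range j) = ⊤)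
    {φ : P →ₗ⁅k⁆ SplitExtension (polyAction k A B)} (hφi : ∀ a, φ (i a) = polyLeft k A B a)
    (hφj : ∀ b, φ (j b) = polyRight k A B b) {t : A} {t' : B}
    {α : P →ₗ⁅k⁆ SplitExtension (tensorAction k B hA)}
    (hαi : ∀ a, α (i a) = tensorLeft k B hA t a) (hαj : ∀ b, α (j b) = tensorRight k B hA b)
    {β : P →ₗ⁅k⁆ SplitExtension (tensorAction k A hB)}
    (hβj : ∀ b, β (j b) = tensorLeft k A hB t' b) (hβi : ∀ a, β (i a) = tensorRight k A hB a)
    (ht : t ∉ commutant k A) (ht' : t' ∉ commutant k B) (hTA : CommutantTorsionFree k A)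
    (hTB : CommutantTorsionFree k B) : CommutantTorsionFree k P := by
  intro x hx y hy hxy
  obtain ⟨a, b, w, hw, hxe⟩ := exists_eq_add_add hP hgen x
  have hab : a ∉ commutant k A ∨ b ∉ commutant k B := by
    by_contra! h
    rw [hxe] at hx
    exact hx (add_mem (add_mem (map_mem_commutant i h.1) (map_mem_commutant j h.2)) hw)
  have hxe' : x = j b + i a + w := by rw [hxe, add_comm (i a)]
  have h0 := snd_poly_eq_zero hφi hφj hab hw hxe hy hxy
  have h1 := snd_tensor_eq_zero hαi hαj hTA hab hw hxe hy hxy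
  have h2 := snd_tensor_eq_zero hβj hβi hTB hab.symm hw hxe' hy hxy
  obtain ⟨_, ⟨u, rfl⟩, _, ⟨v, rfl⟩, huv⟩ :=
    Submodule.mem_sup.1 (mem_sweepSup_of_snd_poly hP hgen hφi hφj (y := ⟨y, hy⟩) h0)
  have huv' : (sweep hP i j u : P) + (sweep hP j i v : P) = y := congrArg Subtype.val huv
  rw [← huv', map_add, SplitExtension.snd_add] at h1 h2
  rw [snd_tensor_sweep_swap hP hαj, add_zero] at h1
  rw [snd_tensor_sweep_swap hP hβi, zero_add] at h2
  rw [← huv', sweep_eq_zero_of_snd_tensor hP hαi hαj hTA ht h1,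
    sweep_eq_zero_of_snd_tensor hP hβj hβi hTB ht' h2]
  exact add_zero 0

end Main

/-! ### Quotient homomorphisms -/

section Quotient

variable {k L L' : Type*} [Field k] [LieRing L] [LieAlgebra k L] [LieRing L'] [LieAlgebra k L']

/-- The projection to a quotient Lie algebra, as a homomorphism of Lie algebras. -/
def quotientHom (I : LieIdeal k L) : L →ₗ⁅k⁆ L ⧸ I :=
  { (LieSubmodule.Quotient.mk' I : L →ₗ[k] L ⧸ I) with
    map_lie' := fun {x y} => LieSubmodule.Quotient.mk_bracket I x y }

theorem quotientHom_surjective (I : LieIdeal k L) : Function.Surjective (quotientHom I) :=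
  LieSubmodule.Quotient.surjective_mk' I

theorem quotientHom_eq_zero_iff {I : LieIdeal k L} {x : L} : quotientHom I x = 0 ↔ x ∈ I :=
  LieSubmodule.Quotient.mk_eq_zero I

theorem exists_quotient_lift (I : LieIdeal k L) (f : L →ₗ⁅k⁆ L') (h : ∀ x ∈ I, f x = 0) :
    ∃ φ : L ⧸ I →ₗ⁅k⁆ L', ∀ x, φ (quotientHom I x) = f x := by
  let g : L ⧸ I →ₗ[k] L' := I.toSubmodule.liftQ (f : L →ₗ[k] L') h
  have hg : ∀ x, g (quotientHom I x) = f x := fun x => rfl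
  refine ⟨{ g with map_lie' := ?_ }, hg⟩
  intro x y
  obtain ⟨x, rfl⟩ := quotientHom_surjective I x
  obtain ⟨y, rfl⟩ := quotientHom_surjective I y
  change g ⁅quotientHom I x, quotientHom I y⁆ = ⁅g (quotientHom I x), g (quotientHom I y)⁆
  rw [← LieHom.map_lie, hg, hg, hg, LieHom.map_lie]

end Quotient

/-! ### Canonical maps and universal property of the metabelian product -/

namespace MetabelianProduct

variable (k A B : Type*) [Field k] [LieRing A] [LieAlgebra k A] [LieRing B] [LieAlgebra k B]

theorem isMetabelian : IsMetabelian (MetabelianProduct k A B) := by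
  intro a b c d
  obtain ⟨a, rfl⟩ := quotientHom_surjective _ a
  obtain ⟨b, rfl⟩ := quotientHom_surjective _ b
  obtain ⟨c, rfl⟩ := quotientHom_surjective _ c
  obtain ⟨d, rfl⟩ := quotientHom_surjective _ d
  rw [← LieHom.map_lie, ← LieHom.map_lie, ← LieHom.map_lie, quotientHom_eq_zero_iff]
  exact LieSubmodule.subset_lieSpan (Or.inr ⟨a, b, c, d, rfl⟩)

/-- A homomorphism from the free Lie algebra on all elements of `L` which kills all relations of
`L` induces a homomorphism from `L`. -/
noncomputable def ofRelations {k L P : Type*} [Field k] [LieRing L] [LieAlgebra k L] [LieRing P]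
    [LieAlgebra k P] (F : FreeLieAlgebra k L →ₗ⁅k⁆ P) (h : ∀ r ∈ relations k L, F r = 0) :
    L →ₗ⁅k⁆ P where
  toFun a := F (FreeLieAlgebra.of k a)
  map_add' x y := by
    rw [← map_add, ← sub_eq_zero, ← map_sub]
    exact h _ (by simp [relations])
  map_smul' c x := by
    rw [RingHom.id_apply, ← map_smul, ← sub_eq_zero, ← map_sub]
    exact h _ (by simp [relations])
  map_lie' {x y} := by
    rw [← LieHom.map_lie, ← sub_eq_zero, ← map_sub]
    exact h _ (by simp [relations])

/-- The canonical homomorphism of the first factor to the metabelian product. -/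
noncomputable def inl : A →ₗ⁅k⁆ MetabelianProduct k A B :=
  ofRelations ((quotientHom _).comp
    (FreeLieAlgebra.lift k fun a : A => FreeLieAlgebra.of k (Sum.inl a : A ⊕ B))) fun r hr => by
      rw [LieHom.comp_apply, quotientHom_eq_zero_iff]
      exact LieSubmodule.subset_lieSpan (Or.inl (Or.inl ⟨r, hr, rfl⟩))

/-- The canonical homomorphism of the second factor to the metabelian product. -/
noncomputable def inr : B →ₗ⁅k⁆ MetabelianProduct k A B :=
  ofRelations ((quotientHom _).comp
    (FreeLieAlgebra.lift k fun b : B => FreeLieAlgebra.of k (Sum.inr b : A ⊕ B))) fun r hr => by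
      rw [LieHom.comp_apply, quotientHom_eq_zero_iff]
      exact LieSubmodule.subset_lieSpan (Or.inl (Or.inr ⟨r, hr, rfl⟩))

theorem inl_apply (a : A) :
    inl k A B a = quotientHom _ (FreeLieAlgebra.of k (Sum.inl a : A ⊕ B)) := by
  change quotientHom _ (FreeLieAlgebra.lift k _ (FreeLieAlgebra.of k a)) = _
  rw [FreeLieAlgebra.lift_of_apply]

theorem inr_apply (b : B) :
    inr k A B b = quotientHom _ (FreeLieAlgebra.of k (Sum.inr b : A ⊕ B)) := by
  change quotientHom _ (FreeLieAlgebra.lift k _ (FreeLieAlgebra.of k b)) = _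
  rw [FreeLieAlgebra.lift_of_apply]

/-- The lift of the generators into `K`, followed by the inclusion, fixes the generators and is
therefore the identity. -/
theorem freeLieAlgebra_mem {k X : Type*} [Field k] (K : LieSubalgebra k (FreeLieAlgebra k X))
    (h : ∀ x, FreeLieAlgebra.of k x ∈ K) (z : FreeLieAlgebra k X) : z ∈ K := by
  let F : FreeLieAlgebra k X →ₗ⁅k⁆ K :=
    FreeLieAlgebra.lift k fun x => ⟨FreeLieAlgebra.of k x, h x⟩
  have hF : K.incl.comp F = LieHom.id := FreeLieAlgebra.hom_ext fun x => by
    rw [LieHom.comp_apply, FreeLieAlgebra.lift_of_apply]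
    rfl
  have : (K.incl.comp F) z = z := by rw [hF]; rfl
  rw [← this]
  exact (F z).2

theorem lieSpan_range_union_range :
    LieSubalgebra.lieSpan k (MetabelianProduct k A B)
      (Set.range (inl k A B) ∪ Set.range (inr k A B)) = ⊤ := by
  rw [eq_top_iff]
  intro p _
  obtain ⟨z, rfl⟩ := quotientHom_surjective _ p
  refine freeLieAlgebra_mem ((LieSubalgebra.lieSpan k (MetabelianProduct k A B)
      (Set.range (inl k A B) ∪ Set.range (inr k A B))).comap (quotientHom _)) ?_ z
  rintro (a | b)
  · exact LieSubalgebra.subset_lieSpan (Or.inl ⟨a, inl_apply k A B a⟩)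
  · exact LieSubalgebra.subset_lieSpan (Or.inr ⟨b, inr_apply k A B b⟩)

variable {k A B} in
/-- The universal property of the metabelian product. -/
theorem exists_lift {L : Type*} [LieRing L] [LieAlgebra k L] (hL : IsMetabelian L)
    (f : A →ₗ⁅k⁆ L) (g : B →ₗ⁅k⁆ L) : ∃ φ : MetabelianProduct k A B →ₗ⁅k⁆ L,
      (∀ a, φ (inl k A B a) = f a) ∧ ∀ b, φ (inr k A B b) = g b := by
  let F : FreeLieAlgebra k (A ⊕ B) →ₗ⁅k⁆ L := FreeLieAlgebra.lift k (Sum.elim f g)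
  have hf : F.comp (FreeLieAlgebra.lift k fun a : A => FreeLieAlgebra.of k (Sum.inl a : A ⊕ B)) =
      f.comp (FreeLieAlgebra.lift k id) := FreeLieAlgebra.hom_ext fun a => by simp [F]
  have hg : F.comp (FreeLieAlgebra.lift k fun b : B => FreeLieAlgebra.of k (Sum.inr b : A ⊕ B)) =
      g.comp (FreeLieAlgebra.lift k id) := FreeLieAlgebra.hom_ext fun a => by simp [F]
  obtain ⟨φ, hφ⟩ := exists_quotient_lift (relatorIdeal k (A ⊕ B) _) F
    (show relatorIdeal k (A ⊕ B)
      (FreeLieAlgebra.lift k (fun a : A => FreeLieAlgebra.of k (Sum.inl a : A ⊕ B)) ''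
        relations k A ∪
      FreeLieAlgebra.lift k (fun b : B => FreeLieAlgebra.of k (Sum.inr b : A ⊕ B)) ''
        relations k B) ≤ F.ker from by
      refine LieSubmodule.lieSpan_le.2 ?_
      rintro _ ((⟨r, hr, rfl⟩ | ⟨r, hr, rfl⟩) | ⟨a, b, c, d, rfl⟩)
      · rw [SetLike.mem_coe, LieHom.mem_ker, ← LieHom.comp_apply, hf, LieHom.comp_apply,
          show FreeLieAlgebra.lift k id r = 0 from hr, map_zero]
      · rw [SetLike.mem_coe, LieHom.mem_ker, ← LieHom.comp_apply, hg, LieHom.comp_apply,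
          show FreeLieAlgebra.lift k id r = 0 from hr, map_zero]
      · rw [SetLike.mem_coe, LieHom.mem_ker, LieHom.map_lie, LieHom.map_lie, LieHom.map_lie]
        exact hL _ _ _ _)
  refine ⟨φ, fun a => ?_, fun b => ?_⟩
  · rw [inl_apply, hφ]; simp [F]
  · rw [inr_apply, hφ]; simp [F]

end MetabelianProduct

/-! ### The Fitting radical of the product, and the final equivalences -/

section FittingRadical

variable {k A B : Type*} [Field k] [LieRing A] [LieAlgebra k A] [LieRing B] [LieAlgebra k B]

theorem exists_functional_of_notMem_commutant {a : A} (ha : a ∉ commutant k A) :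
    ∃ f : A →ₗ[k] k, (∀ x y : A, f ⁅x, y⁆ = 0) ∧ f a = 1 := by
  rw [← linForm_eq_zero_iff, ← ne_eq, MvPolynomial.ne_zero_iff] at ha
  obtain ⟨d, hd⟩ := ha
  refine ⟨(MvPolynomial.coeff d (linForm k A a))⁻¹ • MvPolynomial.lcoeff k d ∘ₗ linForm k A,
    fun x y => ?_, ?_⟩
  · simp
  · simp [hd]

/-- The homomorphism to the two-dimensional nonabelian Lie algebra whose image acts. -/
def planeLeft (f : A →ₗ[k] k) (hf : ∀ x y : A, f ⁅x, y⁆ = 0) :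
    A →ₗ⁅k⁆ SplitExtension (Algebra.lmul k k) :=
  SplitExtension.homMk f 0 hf (fun x y => by simp)

/-- The homomorphism to the two-dimensional nonabelian Lie algebra with image in the commutant. -/
def planeRight (f : A →ₗ[k] k) (hf : ∀ x y : A, f ⁅x, y⁆ = 0) :
    A →ₗ⁅k⁆ SplitExtension (Algebra.lmul k k) :=
  SplitExtension.homMk 0 f (fun x y => by simp) (fun x y => by simp [hf])

/-- All iterates of ad x on `c` have the same nonzero image, whereas an element of a nilpotent ideal
has nilpotent ad. -/
theorem notMem_of_map_plane {P : Type*} [LieRing P] [LieAlgebra k P]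
    (φ : P →ₗ⁅k⁆ SplitExtension (Algebra.lmul k k)) {x c : P} (hx : (φ x).fst = 1)
    (hc : c ∈ commutant k P) (hφc : (φ c).snd ≠ 0) {I : LieIdeal k P}
    (hI : LieRing.IsNilpotent I) : x ∉ I := by
  intro hxI
  obtain ⟨n, hn⟩ := exists_pow_toEnd_eq_zero_of_mem_nilpotent hI hxI
  have key : ∀ m : ℕ, ((toEnd k P P x) ^ m) c ∈ commutant k P ∧
      (φ (((toEnd k P P x) ^ m) c)).snd = (φ c).snd := by
    intro m
    induction m with
    | zero => exact ⟨hc, rfl⟩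
    | succ m ih =>
      rw [pow_succ', Module.End.mul_apply, toEnd_apply_apply]
      refine ⟨lie_mem_commutant _ _, ?_⟩
      rw [SplitExtension.snd_map_lie φ x ih.1, hx, map_one, Module.End.one_apply, ih.2]
  apply hφc
  rw [← (key n).2, hn, map_zero, SplitExtension.snd_zero]

variable [Nontrivial A] [Nontrivial B]

/-- If the component of `x` in one factor is outside that factor's commutant, let this factor act on
the plane and send the other, which is nonzero, into the abelian ideal. Then ad x is not nilpotent
on a mixed product. -/
theorem fittingRadical_metabelianProduct (hA : IsMetabelian A) (hB : IsMetabelian B) :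
    fittingRadical k (MetabelianProduct k A B) = commutant k (MetabelianProduct k A B) := by
  have hP := MetabelianProduct.isMetabelian k A B
  refine le_antisymm (LieSubmodule.lieSpan_le.2 ?_) hP.commutant_le_fittingRadical
  rintro x ⟨I, hI, hxI⟩
  obtain ⟨a, b, w, hw, rfl⟩ :=
    exists_eq_add_add hP (MetabelianProduct.lieSpan_range_union_range k A B) x
  obtain ⟨t, ht⟩ := hA.exists_notMem_commutant (k := k)
  obtain ⟨t', ht'⟩ := hB.exists_notMem_commutant (k := k)
  by_cases ha : a ∈ commutant k A
  · by_cases hb : b ∈ commutant k B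
    · exact add_mem (add_mem (map_mem_commutant _ ha) (map_mem_commutant _ hb)) hw
    · exfalso
      obtain ⟨f, hf, hft⟩ := exists_functional_of_notMem_commutant ht
      obtain ⟨g, hg, hgb⟩ := exists_functional_of_notMem_commutant hb
      obtain ⟨φ, h1, h2⟩ := MetabelianProduct.exists_lift
        (SplitExtension.isMetabelian (Algebra.lmul k k)) (planeRight f hf) (planeLeft g hg)
      refine notMem_of_map_plane φ (c := ⁅MetabelianProduct.inr k A B b,
        MetabelianProduct.inl k A B t⁆) ?_ (lie_mem_commutant _ _) ?_ hI hxI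
      · rw [map_add, map_add, SplitExtension.fst_add, SplitExtension.fst_add,
          SplitExtension.fst_map_eq_zero φ hw, h1, h2]
        simp [planeLeft, planeRight, hgb]
      · rw [LieHom.map_lie, h1, h2]
        simp [planeLeft, planeRight, hgb, hft]
  · exfalso
    obtain ⟨f, hf, hfa⟩ := exists_functional_of_notMem_commutant ha
    obtain ⟨g, hg, hgt⟩ := exists_functional_of_notMem_commutant ht'
    obtain ⟨φ, h1, h2⟩ := MetabelianProduct.exists_lift
      (SplitExtension.isMetabelian (Algebra.lmul k k)) (planeLeft f hf) (planeRight g hg)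
    refine notMem_of_map_plane φ (c := ⁅MetabelianProduct.inl k A B a,
      MetabelianProduct.inr k A B t'⁆) ?_ (lie_mem_commutant _ _) ?_ hI hxI
    · rw [map_add, map_add, SplitExtension.fst_add, SplitExtension.fst_add,
        SplitExtension.fst_map_eq_zero φ hw, h1, h2]
      simp [planeLeft, planeRight, hfa]
    · rw [LieHom.map_lie, h1, h2]
      simp [planeLeft, planeRight, hfa, hgt]

theorem not_isLieAbelian_metabelianProduct (hA : IsMetabelian A) (hB : IsMetabelian B) :
    ¬ IsLieAbelian (MetabelianProduct k A B) := by
  intro h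
  obtain ⟨t, ht⟩ := hA.exists_notMem_commutant (k := k)
  obtain ⟨t', ht'⟩ := hB.exists_notMem_commutant (k := k)
  obtain ⟨f, hf, hft⟩ := exists_functional_of_notMem_commutant ht
  obtain ⟨g, hg, hgt⟩ := exists_functional_of_notMem_commutant ht'
  obtain ⟨φ, h1, h2⟩ := MetabelianProduct.exists_lift
    (SplitExtension.isMetabelian (Algebra.lmul k k)) (planeLeft f hf) (planeRight g hg)
  have := congrArg (fun z => (φ z).snd)
    (h.trivial (MetabelianProduct.inl k A B t) (MetabelianProduct.inr k A B t'))
  simp [h1, h2, planeLeft, planeRight, hft, hgt] at this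

theorem isSemidomain_metabelianProduct_iff (hA : IsMetabelian A) (hB : IsMetabelian B) :
    IsSemidomain k (MetabelianProduct k A B) ↔
      CommutantTorsionFree k (MetabelianProduct k A B) := by
  rw [IsSemidomain, fittingRadical_metabelianProduct hA hB,
    ← isLieAbelian_or_isStrictSemidomain_iff (MetabelianProduct.isMetabelian k A B)]
  exact (or_iff_right (not_isLieAbelian_metabelianProduct hA hB)).symm

end FittingRadical

/-- The retraction ensures that elements outside L² stay outside P² and that `i` is injective. -/
theorem CommutantTorsionFree.of_retraction {k L P : Type*} [Field k] [LieRing L] [LieAlgebra k L]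
    [LieRing P] [LieAlgebra k P] (h : CommutantTorsionFree k P) (i : L →ₗ⁅k⁆ P) (r : P →ₗ⁅k⁆ L)
    (hri : ∀ a, r (i a) = a) : CommutantTorsionFree k L := by
  intro x hx y hy hxy
  have h0 : i y = 0 := by
    refine h (i x) (fun hix => hx ?_) (i y) (map_mem_commutant i hy) ?_
    · rw [← hri x]
      exact map_mem_commutant r hix
    · rw [← LieHom.map_lie, hxy, map_zero]
  rw [← hri y, h0, map_zero]

theorem commutantTorsionFree_metabelianProduct_iff {k A B : Type*} [Field k] [LieRing A]
    [LieAlgebra k A] [LieRing B] [LieAlgebra k B] [Nontrivial A] [Nontrivial B]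
    (hA : IsMetabelian A) (hB : IsMetabelian B) :
    CommutantTorsionFree k (MetabelianProduct k A B) ↔
      CommutantTorsionFree k A ∧ CommutantTorsionFree k B := by
  constructor
  · intro h
    -- Killing the other factor retracts the product onto each factor.
    obtain ⟨r, hr, -⟩ := MetabelianProduct.exists_lift hA (LieHom.id : A →ₗ⁅k⁆ A)
      (0 : B →ₗ⁅k⁆ A)
    obtain ⟨r', -, hr'⟩ := MetabelianProduct.exists_lift hB (0 : A →ₗ⁅k⁆ B)
      (LieHom.id : B →ₗ⁅k⁆ B)
    exact ⟨h.of_retraction _ r hr, h.of_retraction _ r' hr'⟩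
  · rintro ⟨hTA, hTB⟩
    obtain ⟨t, ht⟩ := hA.exists_notMem_commutant (k := k)
    obtain ⟨t', ht'⟩ := hB.exists_notMem_commutant (k := k)
    obtain ⟨φ, hφ, hφ'⟩ := MetabelianProduct.exists_lift (SplitExtension.isMetabelian _)
      (polyLeft k A B) (polyRight k A B)
    obtain ⟨α, hα, hα'⟩ := MetabelianProduct.exists_lift (SplitExtension.isMetabelian _)
      (tensorLeft k B hA t) (tensorRight k B hA)
    obtain ⟨β, hβ, hβ'⟩ := MetabelianProduct.exists_lift (SplitExtension.isMetabelian _)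
      (tensorRight k A hB) (tensorLeft k A hB t')
    exact commutantTorsionFree_of_homs (MetabelianProduct.isMetabelian k A B)
      (MetabelianProduct.lieSpan_range_union_range k A B) hφ hφ' hα hα' hβ' hβ ht ht' hTA hTB

end MetabelianLie

theorem theorem3 {k : Type*} [Field k]
    {A : Type*} [LieRing A] [LieAlgebra k A] [Nontrivial A]
    {B : Type*} [LieRing B] [LieAlgebra k B] [Nontrivial B]
    (hA : MetabelianLie.IsMetabelian A) (hB : MetabelianLie.IsMetabelian B) :
    MetabelianLie.IsSemidomain k (MetabelianLie.MetabelianProduct k A B) ↔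
      (IsLieAbelian A ∨ MetabelianLie.IsStrictSemidomain k A) ∧
        (IsLieAbelian B ∨ MetabelianLie.IsStrictSemidomain k B) := by
  rw [MetabelianLie.isSemidomain_metabelianProduct_iff hA hB,
    MetabelianLie.commutantTorsionFree_metabelianProduct_iff hA hB,
    MetabelianLie.isLieAbelian_or_isStrictSemidomain_iff hA,
    MetabelianLie.isLieAbelian_or_isStrictSemidomain_iff hB]
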